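/- Let $d\ge 4$ be an integer, let $F$ be a field and let $X=\{x_1,\dots,x_d\}$ be a set with $d$ elements; $X^n$ denotes the set of words of length $n$ over $X$. For $n\ge 1$ let $\Omega_n=\mathrm{SL}_{X^n}(F)$ be the special linear group of matrices with rows and columns indexed by $X^n$. For $1\le m\le n$ let $\iota_{m,n}\colon \Omega_m\to\Omega_n$ be the block diagonal inclusion $A\mapsto A\otimes 1$, i.e. for $u,v\in X^m$ and $u',v'\in X^{n-m}$ the entry of $\iota_{m,n}(A)$ at $(uu',vv')$ is $A_{u,v}$ if $u'=v'$ and $0$ otherwise. Let $B=\mathrm{SL}_{\{x_1,x_2\}\times X}(F)\cong \mathrm{SL}_{2d}(F)$, and for $n\ge 2$ let $\phi_n\colon B\to\Omega_n$ be the embedding induced by the injection $\{x_1,x_2\}\times X\to X^n$, $u\mapsto x_d^{\,n-2}u$ (matrices are extended by the identity outside the image of this injection). Let $P\Omega_n=\Omega_n/Z(\Omega_n)$ be the quotient of $\Omega_n$ by its center. The maps $\iota_{m,n}$ send centers into centers, so they induce homomorphisms $\bar\iota_{m,n}\colon P\Omega_m\to P\Omega_n$; let $\bar\phi_n\colon B\to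 P\Omega_n$ be the composition of $\phi_n$ with the projection. The system $\mathcal{PSL}_d(F)=((P\Omega_n)_{n\ge 1},(\bar\phi_n)_{n\ge 2})$ is a telescope over $B$: for every $n\geq 2$ the group $P\Omega_n$ is generated by the conjugates of $\bar\phi_n(B)$ by elements of $\bar\iota_{n-1,n}(P\Omega_{n-1})$, and $\bar\iota_{m,n}(\bar\phi_m(B))$ commutes elementwise with $\bar\phi_n(B)$ for $2\le m<n$. For $i\ge 1$ and $\omega\in P\Omega_i$ let $\Delta_i(\omega)\in\prod_{j\ge 1}P\Omega_j$ be the element whose $j$-th coordinate is $1$ for $j<i$ and $\bar\iota_{i,j}(\omega)$ for $j\ge i$. For $b\in B$ let $\tilde b\in\prod_{j\ge 1}P\Omega_j$ be the element whose $j$-th coordinate is $\prod_{k=2}^{j}\bar\iota_{k,j}(\bar\phi_k(b))$. Let $\widetilde G\le\prod_{j\ge 1}P\Omega_j$ be the subgroup generated by all $\Delta_i(\omega)$ with $i\ge 1$, $\omega\in P\Omega_i$, and all $\tilde b$ with $b\in B$. It contains the direct sum $\bigoplus_{j\ge 1}P\Omega_j$ (the elements with only finitely many non-trivial coordinates) as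 a normal subgroup. Then the head $Q_{\mathcal{PSL}_d(F)}=\widetilde G/\bigoplus_{j\ge 1}P\Omega_j$ is a simple group. -/

import Mathlib

open Matrix

/-! ### Telescopes of groups, their huge group and their head -/

/-- A `B`-telescope: a directed system of groups `Ω_1 → Ω_2 → Ω_3 → ⋯` with homomorphisms
`φ_n : B → Ω_n` for `n ≥ 2`, such that `Ω_n` is generated by the conjugates of `B_n = φ_n(B)` by
elements of the image of `Ω_{n-1}`, and such that the image of `B_m` in `Ω_n` commutes with `B_n`
for `2 ≤ m < n`.

Indices are shifted so as to start at `0`: the field `Ω i` is the group `Ω_{i+1}`, and `φ i` is the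
homomorphism `φ_{i+2} : B → Ω_{i+2}`. The map `ι i i` is the identity. -/
structure Telescope (B : Type*) [Group B] where
  Ω : ℕ → Type*
  [group : ∀ i, Group (Ω i)]
  ι : ∀ i j, i ≤ j → (Ω i →* Ω j)
  ι_refl : ∀ i (ω : Ω i), ι i i le_rfl ω = ω
  ι_trans : ∀ i j k (hij : i ≤ j) (hjk : j ≤ k) (ω : Ω i),
    ι j k hjk (ι i j hij ω) = ι i k (hij.trans hjk) ω
  φ : ∀ i, B →* Ω (i + 1)
  generation : ∀ i, Subgroup.closure
    {x | ∃ (h : Ω i) (b : B), x = ι i (i + 1) i.le_succ h * φ i b * (ι i (i + 1) i.le_succ h)⁻¹} = ⊤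
  commutator : ∀ i j (hij : i < j) (b c : B),
    Commute (ι (i + 1) (j + 1) (Nat.succ_le_succ hij.le) (φ i b)) (φ j c)

namespace Telescope

attribute [instance] Telescope.group

variable {B : Type*} [Group B] (S : Telescope B)

/-- The homomorphism `Δ_i : Ω_i → ∏ Ω_j`, `ω ↦ (1, …, 1, ω, ι_{i,i+1}(ω), ι_{i,i+2}(ω), …)`. -/
def delta (i : ℕ) (ω : S.Ω i) : ∀ j, S.Ω j :=
  fun j => if h : i ≤ j then S.ι i j h ω else 1

/-- The element `b̃ = b̃^{[1]}` of `∏ Ω_j`: its coordinate at `j` is the (ordered) product over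
`i < j` of the images in `Ω j` of the elements `φ i b ∈ Ω (i + 1)`. The factors commute pairwise. -/
def tilde (b : B) : ∀ j, S.Ω j :=
  fun j => (List.ofFn fun i : Fin j => S.ι (i + 1) j i.isLt (S.φ i b)).prod

/-- The huge group of the telescope, generated by all `Δ_i(Ω_i)` and all `b̃` with `b ∈ B`. -/
def hugeGroup : Subgroup (∀ j, S.Ω j) :=
  Subgroup.closure ((⋃ i, Set.range (S.delta i)) ∪ Set.range S.tilde)

/-- The direct sum `⨁ Ω_j`, as the subgroup of all finitely supported elements of `∏ Ω_j`. -/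
def directSum : Subgroup (∀ j, S.Ω j) where
  carrier := {f | {j | f j ≠ 1}.Finite}
  one_mem' := by simp
  mul_mem' := by
    intro f g hf hg
    refine (hf.union hg).subset fun j hj => ?_
    by_contra h
    simp only [Set.mem_union, Set.mem_ofPred_eq, not_or, not_not] at h
    exact hj (by rw [Pi.mul_apply, h.1, h.2, mul_one])
  inv_mem' := by
    intro f hf
    simpa using hf

instance directSum_normal : S.directSum.Normal where
  conj_mem := by
    intro f hf g
    refine Set.Finite.subset hf fun j hj => ?_
    intro h
    exact hj (by simp [h])

/-- The direct sum is contained in the huge group. -/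
theorem directSum_le_hugeGroup : S.directSum ≤ S.hugeGroup := by
  classical
  have key : ∀ i (ω : S.Ω i), Pi.mulSingle i ω ∈ S.hugeGroup := by
    intro i ω
    have h1 : S.delta i ω ∈ S.hugeGroup :=
      Subgroup.subset_closure (Or.inl (Set.mem_iUnion.2 ⟨i, ω, rfl⟩))
    have h2 : S.delta (i + 1) (S.ι i (i + 1) i.le_succ ω⁻¹) ∈ S.hugeGroup :=
      Subgroup.subset_closure (Or.inl (Set.mem_iUnion.2 ⟨i + 1, _, rfl⟩))
    have h3 : Pi.mulSingle i ω =
        S.delta i ω * S.delta (i + 1) (S.ι i (i + 1) i.le_succ ω⁻¹) := by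
      funext j
      simp only [Pi.mul_apply, delta]
      rcases lt_trichotomy i j with h | h | h
      · rw [dif_pos h.le, dif_pos (Nat.succ_le_of_lt h), S.ι_trans,
          Pi.mulSingle_eq_of_ne (by omega)]
        simp
      · subst h
        simp [S.ι_refl]
      · rw [dif_neg (by omega), dif_neg (by omega), Pi.mulSingle_eq_of_ne (by omega)]
        simp
    rw [h3]
    exact mul_mem h1 h2
  have main : ∀ (s : Finset ℕ) (f : ∀ j, S.Ω j), (∀ j, f j ≠ 1 → j ∈ s) → f ∈ S.hugeGroup := by
    intro s
    induction s using Finset.induction_on with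
    | empty =>
      intro f hf
      have : f = 1 := by
        funext j
        by_contra h
        exact absurd (hf j h) (by simp)
      rw [this]
      exact one_mem _
    | insert a s ha ih =>
      intro f hf
      have h1 : f * Pi.mulSingle a (f a)⁻¹ ∈ S.hugeGroup := by
        apply ih
        intro j hj
        by_cases hja : j = a
        · subst hja
          simp at hj
        · rw [Pi.mul_apply, Pi.mulSingle_eq_of_ne hja, mul_one] at hj
          exact (Finset.mem_insert.1 (hf j hj)).resolve_left hja
      have h2 := mul_mem h1 (key a (f a))
      rw [mul_assoc, ← Pi.mulSingle_mul] at h2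
      simpa using h2
  intro f hf
  exact main (Set.Finite.toFinset hf) f fun j hj => (Set.Finite.mem_toFinset hf).2 hj

/-- The head `Q` of the telescope: the quotient of the huge group by the direct sum. -/
abbrev head : Type _ :=
  S.hugeGroup ⧸ S.directSum.subgroupOf S.hugeGroup

/-- The quotient telescope `(Ω_i / M_i)`, for normal subgroups `M_i` that are preserved by the
transition maps. -/
def quotient (M : ∀ i, Subgroup (S.Ω i)) [hN : ∀ i, (M i).Normal]
    (hM : ∀ i j (h : i ≤ j), M i ≤ (M j).comap (S.ι i j h)) : Telescope B where
  Ω := fun i => S.Ω i ⧸ M i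
  ι := fun i j h => QuotientGroup.map (M i) (M j) (S.ι i j h) (hM i j h)
  ι_refl := by
    intro i ω
    induction ω using QuotientGroup.induction_on with
    | H ω => simp [S.ι_refl]
  ι_trans := by
    intro i j k hij hjk ω
    induction ω using QuotientGroup.induction_on with
    | H ω => simp [S.ι_trans]
  φ := fun i => (QuotientGroup.mk' (M (i + 1))).comp (S.φ i)
  generation := by
    intro i
    have h := congrArg (Subgroup.map (QuotientGroup.mk' (M (i + 1)))) (S.generation i)
    rw [MonoidHom.map_closure, Subgroup.map_top_of_surjective _ (QuotientGroup.mk'_surjective _)]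
      at h
    rw [eq_top_iff, ← h, Subgroup.closure_le]
    rintro _ ⟨_, ⟨g, b, rfl⟩, rfl⟩
    exact Subgroup.subset_closure ⟨(g : S.Ω i ⧸ M i), b, by simp⟩
  commutator := by
    intro i j hij b c
    exact (S.commutator i j hij b c).map (QuotientGroup.mk' (M (j + 1)))

end Telescope

/-! ### Special linear groups over words -/

namespace WordMatrix

section Extension

variable {Y Z F : Type*} [Fintype Y] [DecidableEq Y] [Fintype Z] [DecidableEq Z] [CommRing F]

theorem slExt {A A' : Matrix.SpecialLinearGroup Y F} (h : (A : Matrix Y Y F) = (A' : Matrix Y Y F)) :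
    A = A' := Subtype.ext h

/-- An injection `f : Y ↪ Z` splits `Z` into `Y` and the complement of the range of `f`. -/
noncomputable def splitEquiv (f : Y ↪ Z) : Y ⊕ {z // z ∉ Set.range f} ≃ Z := by
  classical
  exact (Equiv.sumCongr (Equiv.ofInjective f f.injective) (Equiv.refl _)).trans
    (Equiv.sumCompl fun z => z ∈ Set.range f)

open Classical in
/-- The embedding `SL_Y(F) → SL_Z(F)` induced by an injection `f : Y ↪ Z`: the image of `A` is the
matrix supported in `f(Y)` whose block with rows and columns in `f(Y)` is `A`. -/
noncomputable def extend (f : Y ↪ Z) : Matrix.SpecialLinearGroup Y F →* Matrix.SpecialLinearGroup Z F where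
  toFun A := ⟨reindex (splitEquiv f) (splitEquiv f) (fromBlocks (A : Matrix Y Y F) 0 0 1), by
    rw [reindex_apply, det_submatrix_equiv_self, det_fromBlocks_zero₂₁]
    simp⟩
  map_one' := by
    apply slExt
    simp
  map_mul' A A' := by
    apply slExt
    change reindex (splitEquiv f) (splitEquiv f)
        (fromBlocks ((A : Matrix Y Y F) * (A' : Matrix Y Y F)) 0 0 1) =
      reindex (splitEquiv f) (splitEquiv f) (fromBlocks (A : Matrix Y Y F) 0 0 1) *
        reindex (splitEquiv f) (splitEquiv f) (fromBlocks (A' : Matrix Y Y F) 0 0 1)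
    simp [submatrix_mul_equiv, fromBlocks_multiply]

theorem coe_extend (f : Y ↪ Z) (A : Matrix.SpecialLinearGroup Y F) :
    (extend f A : Matrix Z Z F) =
      reindex (splitEquiv f) (splitEquiv f) (fromBlocks (A : Matrix Y Y F) 0 0 1) := by
  classical
  exact congrArg (reindex (splitEquiv f) (splitEquiv f)) (by congr!)

theorem splitEquiv_inl (f : Y ↪ Z) (y : Y) : splitEquiv f (Sum.inl y) = f y := rfl

theorem splitEquiv_inr (f : Y ↪ Z) (z : {z // z ∉ Set.range f}) :
    splitEquiv f (Sum.inr z) = z := rfl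

theorem splitEquiv_symm_apply (f : Y ↪ Z) (y : Y) : (splitEquiv f).symm (f y) = Sum.inl y := by
  rw [Equiv.symm_apply_eq, splitEquiv_inl]

theorem splitEquiv_symm_of_notMem (f : Y ↪ Z) (z : Z) (hz : z ∉ Set.range f) :
    (splitEquiv f).symm z = Sum.inr ⟨z, hz⟩ := by
  rw [Equiv.symm_apply_eq, splitEquiv_inr]

theorem extend_apply (f : Y ↪ Z) (A : Matrix.SpecialLinearGroup Y F) (p q : Y) :
    (extend f A : Matrix Z Z F) (f p) (f q) = (A : Matrix Y Y F) p q := by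
  simp [coe_extend, splitEquiv_symm_apply]

theorem extend_apply_of_notMem (f : Y ↪ Z) (A : Matrix.SpecialLinearGroup Y F) (u v : Z)
    (h : u ∉ Set.range f ∨ v ∉ Set.range f) :
    (extend f A : Matrix Z Z F) u v = (1 : Matrix Z Z F) u v := by
  classical
  obtain ⟨u, rfl⟩ := (splitEquiv f).surjective u
  obtain ⟨v, rfl⟩ := (splitEquiv f).surjective v
  rw [coe_extend, Matrix.one_apply]
  simp only [EmbeddingLike.apply_eq_iff_eq]
  rcases u with u | u <;> rcases v with v | v
  · exfalso
    simp [splitEquiv_inl] at h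
  · simp
  · simp
  · simp [Matrix.one_apply]

theorem eq_extend (f : Y ↪ Z) (A : Matrix.SpecialLinearGroup Y F) (M : Matrix Z Z F)
    (h1 : ∀ p q, M (f p) (f q) = (A : Matrix Y Y F) p q)
    (h2 : ∀ u v, u ∉ Set.range f ∨ v ∉ Set.range f → M u v = (1 : Matrix Z Z F) u v) :
    M = extend f A := by
  ext u v
  by_cases h : u ∉ Set.range f ∨ v ∉ Set.range f
  · rw [h2 u v h, extend_apply_of_notMem f A u v h]
  · push Not at h
    obtain ⟨⟨p, rfl⟩, ⟨q, rfl⟩⟩ := h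
    rw [h1, extend_apply]

/-- `A` is supported in `T`. -/
def SupportedIn (T : Set Z) (A : Matrix Z Z F) : Prop :=
  ∀ u v, u ∉ T ∨ v ∉ T → A u v = (1 : Matrix Z Z F) u v

theorem SupportedIn.commute {T U : Set Z} (h : Disjoint T U) {A A' : Matrix Z Z F}
    (hA : SupportedIn T A) (hA' : SupportedIn U A') : A * A' = A' * A := by
  have aux : ∀ {T U : Set Z} (_ : Disjoint T U) {A A' : Matrix Z Z F}
      (_ : SupportedIn T A) (_ : SupportedIn U A'), (A - 1) * (A' - 1) = 0 := by
    intro T U h A A' hA hA'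
    ext u v
    rw [Matrix.mul_apply]
    apply Finset.sum_eq_zero
    intro w _
    by_cases hw : w ∈ T
    · rw [Matrix.sub_apply A' 1, hA' w v (Or.inl (Set.disjoint_left.1 h hw)), sub_self, mul_zero]
    · rw [Matrix.sub_apply A 1, hA u w (Or.inr hw), sub_self, zero_mul]
  have e1 := aux h hA hA'
  have e2 := aux h.symm hA' hA
  have e3 : A * A' - A' * A = (A - 1) * (A' - 1) - (A' - 1) * (A - 1) := by noncomm_ring
  rw [e1, e2, sub_self] at e3
  exact sub_eq_zero.1 e3

end Extension

section Generation

variable {Y Z F : Type*} [Fintype Y] [DecidableEq Y] [Fintype Z] [DecidableEq Z] [Field F]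

theorem extend_transvection (f : Y ↪ Z) {p q : Y} (h : p ≠ q) (c : F) :
    extend f (Matrix.SpecialLinearGroup.transvection h c) =
      Matrix.SpecialLinearGroup.transvection (f.injective.ne h) c := by
  apply slExt
  symm
  apply eq_extend
  · intro p' q'
    simp [Matrix.one_apply, Matrix.single_apply, Matrix.SpecialLinearGroup.transvection_coe]
  · intro u v huv
    rw [Matrix.SpecialLinearGroup.transvection_coe, Matrix.add_apply, Matrix.single_apply, if_neg, add_zero]
    rintro ⟨rfl, rfl⟩
    simp at huv

theorem extend_diag2n (f : Y ↪ Z) {p q : Y} (h : p ≠ q) (a : F) (ha : a ≠ 0) :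
    extend f (Matrix.SpecialLinearGroup.diag2n h a ha) =
      Matrix.SpecialLinearGroup.diag2n (f.injective.ne h) a ha := by
  apply slExt
  symm
  apply eq_extend
  · intro p' q'
    simp [Matrix.SpecialLinearGroup.diag2n_coe, Matrix.diagonal_apply]
  · intro u v huv
    rw [Matrix.SpecialLinearGroup.diag2n_coe, Matrix.diagonal_apply, Matrix.one_apply]
    by_cases e : u = v
    · subst e
      have hu : u ∉ Set.range f := by simpa using huv
      rw [if_pos rfl, if_pos rfl, if_neg, if_neg]
      · rintro rfl
        exact hu ⟨_, rfl⟩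
      · rintro rfl
        exact hu ⟨_, rfl⟩
    · rw [if_neg e, if_neg e]

/-- The special linear group over a field is generated by the elementary matrices and the diagonal
matrices with at most two entries different from `1`. -/
theorem eq_top_of_transvection_mem (H : Subgroup (Matrix.SpecialLinearGroup Z F))
    (hT : ∀ (y z : Z) (h : y ≠ z) (c : F), Matrix.SpecialLinearGroup.transvection h c ∈ H)
    (hD : ∀ (y z : Z) (h : y ≠ z) (a : F) (ha : a ≠ 0), Matrix.SpecialLinearGroup.diag2n h a ha ∈ H) :
    H = ⊤ := by
  have hdiag : ∀ (D : Z → F) (s : Finset Z) (z : Z), z ∉ s →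
      (∀ x, x ∉ s → x ≠ z → D x = 1) → ∀ (M : Matrix.SpecialLinearGroup Z F),
      (M : Matrix Z Z F) = diagonal D → M ∈ H := by
    intro D s
    induction s using Finset.induction_on generalizing D with
    | empty =>
      intro z _ hz M hM
      have hdet : ∏ x, D x = 1 := by
        rw [← det_diagonal, ← hM]
        exact M.2
      have hDz : D z = 1 := by
        rw [← hdet]
        exact (Finset.prod_eq_single z (fun x _ hx => hz x (by simp) hx) (by simp)).symm
      have : M = 1 := by
        apply slExt
        rw [hM, Matrix.SpecialLinearGroup.coe_one, ← Matrix.diagonal_one]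
        congr 1
        funext x
        by_cases hx : x = z
        · rw [hx, hDz]
        · exact hz x (by simp) hx
      rw [this]
      exact one_mem _
    | insert a s ha ih =>
      intro z hz hx M hM
      have hza : a ≠ z := by
        rintro rfl
        simp at hz
      have hdet : ∏ x, D x = 1 := by
        rw [← det_diagonal, ← hM]
        exact M.2
      have hDa : D a ≠ 0 := by
        intro h0
        rw [Finset.prod_eq_zero (Finset.mem_univ a) h0] at hdet
        exact zero_ne_one hdet
      have hmem := hD a z hza (D a)⁻¹ (inv_ne_zero hDa)
      rw [← Subgroup.mul_mem_cancel_right H hmem]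
      refine ih (fun k => D k * if k = a then (D a)⁻¹ else if k = z then (D a)⁻¹⁻¹ else 1) z
        (fun h => hz (Finset.mem_insert_of_mem h)) ?_ _ ?_
      · intro x hxs hxz
        by_cases hxa : x = a
        · subst hxa
          simp [hDa]
        · simp [hxa, hxz, hx x (by simp [hxa, hxs]) hxz]
      · rw [Matrix.SpecialLinearGroup.coe_mul, hM, Matrix.SpecialLinearGroup.diag2n_coe, diagonal_mul_diagonal]
  have hlist : ∀ L : List (TransvectionStruct Z F), ∃ N ∈ H,
      ((N : Matrix.SpecialLinearGroup Z F) : Matrix Z Z F) =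
        (L.map TransvectionStruct.toMatrix).prod := by
    intro L
    induction L with
    | nil => exact ⟨1, one_mem _, by simp⟩
    | cons t L ih =>
      obtain ⟨N, hN, e⟩ := ih
      refine ⟨t.toSpecialLinearGroup * N, mul_mem (hT _ _ t.hij t.c) hN, ?_⟩
      simp [e]
  rw [eq_top_iff]
  intro M _
  obtain ⟨L, L', D, hM⟩ :=
    Pivot.exists_list_transvec_mul_diagonal_mul_list_transvec (M : Matrix Z Z F)
  obtain ⟨N, hN, eN⟩ := hlist L
  obtain ⟨N', hN', eN'⟩ := hlist L'
  rw [← eN, ← eN'] at hM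
  have hK : ((N⁻¹ * M * N'⁻¹ : Matrix.SpecialLinearGroup Z F) : Matrix Z Z F) = diagonal D := by
    have h1 : ((N⁻¹ : Matrix.SpecialLinearGroup Z F) : Matrix Z Z F) * (N : Matrix Z Z F) = 1 := by
      rw [← Matrix.SpecialLinearGroup.coe_mul, inv_mul_cancel, Matrix.SpecialLinearGroup.coe_one]
    have h2 : (N' : Matrix Z Z F) * ((N'⁻¹ : Matrix.SpecialLinearGroup Z F) : Matrix Z Z F) = 1 := by
      rw [← Matrix.SpecialLinearGroup.coe_mul, mul_inv_cancel, Matrix.SpecialLinearGroup.coe_one]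
    rw [Matrix.SpecialLinearGroup.coe_mul, Matrix.SpecialLinearGroup.coe_mul, hM]
    calc _ = (((N⁻¹ : Matrix.SpecialLinearGroup Z F) : Matrix Z Z F) * (N : Matrix Z Z F)) * diagonal D *
          ((N' : Matrix Z Z F) * ((N'⁻¹ : Matrix.SpecialLinearGroup Z F) : Matrix Z Z F)) := by
            simp only [Matrix.mul_assoc]
      _ = _ := by rw [h1, h2, Matrix.one_mul, Matrix.mul_one]
  have hKH : N⁻¹ * M * N'⁻¹ ∈ H := by
    rcases isEmpty_or_nonempty Z with hZ | ⟨⟨z⟩⟩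
    · have : N⁻¹ * M * N'⁻¹ = 1 := Subsingleton.elim _ _
      rw [this]
      exact one_mem _
    · exact hdiag D (Finset.univ.erase z) z (by simp) (fun x hx hxz => by simp_all) _ hK
  have : M = N * (N⁻¹ * M * N'⁻¹) * N' := by group
  rw [this]
  exact mul_mem (mul_mem hN hKH) hN'

theorem eq_top_of_extend_mem (H : Subgroup (Matrix.SpecialLinearGroup Z F))
    (h : ∀ y z : Z, y ≠ z → ∃ f : Y ↪ Z, y ∈ Set.range f ∧ z ∈ Set.range f ∧
      ∀ A : Matrix.SpecialLinearGroup Y F, extend f A ∈ H) : H = ⊤ := by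
  apply eq_top_of_transvection_mem
  · intro y z hyz c
    obtain ⟨f, ⟨p, rfl⟩, ⟨q, rfl⟩, hf⟩ := h y z hyz
    rw [← extend_transvection f (fun e => hyz (congrArg f e)) c]
    exact hf _
  · intro y z hyz a ha
    obtain ⟨f, ⟨p, rfl⟩, ⟨q, rfl⟩, hf⟩ := h y z hyz
    rw [← extend_diag2n f (fun e => hyz (congrArg f e)) a ha]
    exact hf _

/-- The even permutation `σ`, as a matrix: it maps the basis vector `v` to `σ v`. -/
def permSL (σ : Equiv.Perm Z) (hσ : Equiv.Perm.sign σ = 1) : Matrix.SpecialLinearGroup Z F :=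
  ⟨(1 : Matrix Z Z F).submatrix id σ, by
    have h := det_permute' σ (1 : Matrix Z Z F)
    rw [h, hσ]
    simp⟩

theorem conj_extend (f : Y ↪ Z) (σ : Equiv.Perm Z) (P : Matrix.SpecialLinearGroup Z F)
    (hP : (P : Matrix Z Z F) = (1 : Matrix Z Z F).submatrix id σ) (A : Matrix.SpecialLinearGroup Y F) :
    P * extend f A * P⁻¹ = extend (f.trans σ.toEmbedding) A := by
  rw [mul_inv_eq_iff_eq_mul]
  apply slExt
  rw [Matrix.SpecialLinearGroup.coe_mul, Matrix.SpecialLinearGroup.coe_mul]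
  have hfix : (extend (f.trans σ.toEmbedding) A : Matrix Z Z F).submatrix σ σ = extend f A := by
    apply eq_extend
    · intro p q
      exact extend_apply (f.trans σ.toEmbedding) A p q
    · intro u v huv
      rw [Matrix.submatrix_apply, extend_apply_of_notMem]
      · simp [Matrix.one_apply]
      · simpa using huv
  ext u v
  obtain ⟨u, rfl⟩ := σ.surjective u
  have h := congrFun (congrFun hfix u) v
  rw [Matrix.submatrix_apply] at h
  rw [hP, Matrix.mul_apply, Matrix.mul_apply]
  simp [Matrix.one_apply, h]

end Generation

section Words

variable {X F : Type*} [Fintype X] [DecidableEq X] [CommRing F]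

/-- Splitting a word of length `n` into its prefix of length `m` and the remaining letters. -/
def wordSplit (X : Type*) {m n : ℕ} (h : m ≤ n) :
    (Fin n → X) ≃ (Fin m → X) × ({k : Fin n // m ≤ k} → X) where
  toFun w := (fun k => w (Fin.castLE h k), fun k => w k)
  invFun p := fun k => if hk : (k : ℕ) < m then p.1 ⟨k, hk⟩ else p.2 ⟨k, not_lt.1 hk⟩
  left_inv w := by
    funext k
    by_cases hk : (k : ℕ) < m <;> simp [hk]
  right_inv p := by
    ext k
    · simp
    · simp [not_lt.2 k.2]

/-- The block diagonal inclusion `SL_{X^m}(F) → SL_{X^n}(F)`, `A ↦ A ⊗ 1`, for `m ≤ n`: the entry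
of the image at `(u u', v v')`, with `u, v` of length `m`, is `A u v` if `u' = v'`, and `0`
otherwise. -/
def blockInclusion (F X : Type*) [Fintype X] [DecidableEq X] [CommRing F] {m n : ℕ} (h : m ≤ n) :
    Matrix.SpecialLinearGroup (Fin m → X) F →* Matrix.SpecialLinearGroup (Fin n → X) F where
  toFun A := ⟨(kroneckerMap (· * ·) (A : Matrix (Fin m → X) (Fin m → X) F)
      (1 : Matrix ({k : Fin n // m ≤ k} → X) ({k : Fin n // m ≤ k} → X) F)).submatrix
        (wordSplit X h) (wordSplit X h), by
    rw [det_submatrix_equiv_self, det_kronecker]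
    simp⟩
  map_one' := by
    apply slExt
    simp
  map_mul' A A' := by
    apply slExt
    change (kroneckerMap (· * ·) ((A : Matrix (Fin m → X) (Fin m → X) F) *
        (A' : Matrix (Fin m → X) (Fin m → X) F)) 1).submatrix (wordSplit X h) (wordSplit X h) =
      (kroneckerMap (· * ·) (A : Matrix (Fin m → X) (Fin m → X) F) 1).submatrix
          (wordSplit X h) (wordSplit X h) *
        (kroneckerMap (· * ·) (A' : Matrix (Fin m → X) (Fin m → X) F) 1).submatrix
          (wordSplit X h) (wordSplit X h)
    rw [submatrix_mul_equiv, ← mul_kronecker_mul, Matrix.mul_one]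

theorem coe_blockInclusion {m n : ℕ} (h : m ≤ n) (A : Matrix.SpecialLinearGroup (Fin m → X) F) :
    (blockInclusion F X h A : Matrix (Fin n → X) (Fin n → X) F) =
      (kroneckerMap (· * ·) (A : Matrix (Fin m → X) (Fin m → X) F)
        (1 : Matrix ({k : Fin n // m ≤ k} → X) ({k : Fin n // m ≤ k} → X) F)).submatrix
          (wordSplit X h) (wordSplit X h) := rfl

theorem blockInclusion_apply {m n : ℕ} (h : m ≤ n) (A : Matrix.SpecialLinearGroup (Fin m → X) F)
    (u v : Fin n → X) :
    (blockInclusion F X h A : Matrix (Fin n → X) (Fin n → X) F) u v =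
      if ∀ k : Fin n, m ≤ k → u k = v k then
        (A : Matrix (Fin m → X) (Fin m → X) F)
          (fun k => u (Fin.castLE h k)) (fun k => v (Fin.castLE h k))
      else 0 := by
  simp [coe_blockInclusion, wordSplit, Matrix.one_apply, funext_iff]

theorem blockInclusion_refl {m : ℕ} (A : Matrix.SpecialLinearGroup (Fin m → X) F) :
    blockInclusion F X le_rfl A = A := by
  apply slExt
  ext u v
  rw [blockInclusion_apply, if_pos]
  · rfl
  · intro k hk
    exact absurd k.2 (not_lt.2 hk)

theorem blockInclusion_trans {l m n : ℕ} (h : l ≤ m) (h' : m ≤ n)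
    (A : Matrix.SpecialLinearGroup (Fin l → X) F) :
    blockInclusion F X h' (blockInclusion F X h A) = blockInclusion F X (h.trans h') A := by
  apply slExt
  ext u v
  simp only [blockInclusion_apply]
  by_cases hc : ∀ k : Fin n, l ≤ k → u k = v k
  · rw [if_pos hc, if_pos fun k hk => hc k (h.trans hk),
      if_pos (fun k hk => hc (Fin.castLE h' k) hk :
        ∀ k : Fin m, l ≤ (k : ℕ) → u (Fin.castLE h' k) = v (Fin.castLE h' k))]
    rfl
  · rw [if_neg hc]
    split_ifs with h1 h2
    · exfalso
      apply hc
      intro k hk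
      by_cases hkm : (k : ℕ) < m
      · exact h2 ⟨k, hkm⟩ hk
      · exact h1 k (not_lt.1 hkm)
    · rfl
    · rfl

theorem blockInclusion_center {m n : ℕ} (h : m ≤ n) :
    Subgroup.center (Matrix.SpecialLinearGroup (Fin m → X) F) ≤
      (Subgroup.center (Matrix.SpecialLinearGroup (Fin n → X) F)).comap (blockInclusion F X h) := by
  intro A hA
  obtain ⟨r, -, hA⟩ := Matrix.SpecialLinearGroup.mem_center_iff.1 hA
  have key : ((blockInclusion F X h A : Matrix.SpecialLinearGroup (Fin n → X) F) :
      Matrix (Fin n → X) (Fin n → X) F) = scalar (Fin n → X) r := by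
    ext u v
    rw [blockInclusion_apply, ← hA]
    simp only [scalar_apply, diagonal_apply]
    by_cases huv : u = v
    · subst huv
      simp
    · rw [if_neg huv]
      split_ifs with h1 h2
      · exfalso
        apply huv
        funext k
        by_cases hk : (k : ℕ) < m
        · exact congrFun h2 ⟨k, hk⟩
        · exact h1 k (not_lt.1 hk)
      · rfl
      · rfl
  refine Matrix.SpecialLinearGroup.mem_center_iff.2 ⟨r, ?_, key.symm⟩
  have hdet := (blockInclusion F X h A).2
  rw [key] at hdet
  simpa using! hdet

end Words

/-! ### The telescopes of special linear and of projective special linear groups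

The alphabet is `Fin d = {x_1, …, x_d}`, so that `x_1, x_2` are the letters `0, 1` and `x_d` is the
letter `d - 1`. Words of length `n` are functions `Fin n → Fin d`. -/

/-- The injection `{x_1, x_2} × X → X^{n+2}`, `u ↦ x_d^n u`. -/
def spine {d : ℕ} (hd : 4 ≤ d) (n : ℕ) : Fin 2 × Fin d ↪ (Fin (n + 2) → Fin d) where
  toFun p := fun k =>
    if (k : ℕ) < n then ⟨d - 1, by omega⟩
    else if (k : ℕ) = n then Fin.castLE (by omega) p.1
    else p.2
  inj' := by
    intro p q hpq
    have h0 := congrFun hpq ⟨n, by omega⟩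
    have h1 := congrFun hpq ⟨n + 1, by omega⟩
    simp at h0 h1
    exact Prod.ext h0 h1

theorem spine_apply {d : ℕ} (hd : 4 ≤ d) (n : ℕ) (p : Fin 2 × Fin d) (k : Fin (n + 2)) :
    spine hd n p k = if (k : ℕ) < n then ⟨d - 1, by omega⟩
      else if (k : ℕ) = n then Fin.castLE (by omega) p.1 else p.2 := rfl

theorem generation_aux (F : Type*) [Field F] {d : ℕ} (hd : 4 ≤ d) (n : ℕ) :
    Subgroup.closure {x : Matrix.SpecialLinearGroup (Fin (n + 2) → Fin d) F |
      ∃ (h : Matrix.SpecialLinearGroup (Fin (n + 1) → Fin d) F)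
        (b : Matrix.SpecialLinearGroup (Fin 2 × Fin d) F),
        x = blockInclusion F (Fin d) (Nat.le_succ (n + 1)) h * extend (spine hd n) b *
          (blockInclusion F (Fin d) (Nat.le_succ (n + 1)) h)⁻¹} = ⊤ := by
  classical
  apply eq_top_of_extend_mem (Y := Fin 2 × Fin d)
  intro y z hyz
  let W := Fin (n + 1) → Fin d
  let pre : (Fin (n + 2) → Fin d) → W := fun w k => w (Fin.castLE (Nat.le_succ (n + 1)) k)
  have hcard : 4 ≤ Nat.card W := by
    simp only [W, Nat.card_eq_fintype_card, Fintype.card_fun, Fintype.card_fin]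
    calc 4 ≤ d := hd
      _ = d ^ 1 := (pow_one d).symm
      _ ≤ d ^ (n + 1) := Nat.pow_le_pow_right (by omega) (by omega)
  have : Nontrivial W := by
    rw [← Finite.one_lt_card_iff_nontrivial]
    omega
  have hu : ∃ u : Fin 2 → W, u 0 ≠ u 1 ∧ (∃ a, u a = pre y) ∧ ∃ a, u a = pre z := by
    by_cases h : pre y = pre z
    · obtain ⟨w, hw⟩ := exists_ne (pre y)
      exact ⟨![pre y, w], by simpa using hw.symm, ⟨0, rfl⟩, ⟨0, h⟩⟩
    · exact ⟨![pre y, pre z], by simpa using h, ⟨0, rfl⟩, ⟨1, rfl⟩⟩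
  obtain ⟨u, hu01, ⟨a, ha⟩, ⟨a', ha'⟩⟩ := hu
  let base : Fin 2 → W := fun a k =>
    if (k : ℕ) < n then ⟨d - 1, by omega⟩ else Fin.castLE (by omega) a
  have hbase : base 0 ≠ base 1 := by
    intro e
    have := congrFun e (Fin.last n)
    simp [base] at this
  have hpt := alternatingGroup.isMultiplyPretransitive W
  have h2 : MulAction.IsMultiplyPretransitive (alternatingGroup W) W 2 :=
    MulAction.isMultiplyPretransitive_of_le (n := Nat.card W - 2) (by omega) (by simp)
  obtain ⟨g, hg0, hg1⟩ := MulAction.is_two_pretransitive_iff.1 h2 hbase hu01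
  have hg : ∀ a, (g : Equiv.Perm W) (base a) = u a := by
    intro a
    fin_cases a
    · exact hg0
    · exact hg1
  let e := wordSplit (Fin d) (Nat.le_succ (n + 1))
  let τ : Equiv.Perm (Fin (n + 2) → Fin d) :=
    e.trans ((Equiv.prodCongr (g : Equiv.Perm W) (Equiv.refl _)).trans e.symm)
  let P : Matrix.SpecialLinearGroup W F := permSL (g : Equiv.Perm W) g.2
  have hP : ((blockInclusion F (Fin d) (Nat.le_succ (n + 1)) P :
      Matrix.SpecialLinearGroup (Fin (n + 2) → Fin d) F) :
        Matrix (Fin (n + 2) → Fin d) (Fin (n + 2) → Fin d) F) =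
      (1 : Matrix (Fin (n + 2) → Fin d) (Fin (n + 2) → Fin d) F).submatrix id τ := by
    have h1 : ∀ v, e (τ v) = ((g : Equiv.Perm W) (e v).1, (e v).2) := by
      intro v
      exact e.apply_symm_apply _
    ext v w
    have h3 : (v = τ w) ↔ (e v).1 = (g : Equiv.Perm W) (e w).1 ∧ (e v).2 = (e w).2 := by
      rw [← e.apply_eq_iff_eq, h1, Prod.ext_iff]
    simp only [Matrix.submatrix_apply, id, Matrix.one_apply, h3]
    have h4 : ∀ x y : W, (P : Matrix W W F) x y = if x = (g : Equiv.Perm W) y then 1 else 0 :=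
      fun x y => by simp [P, permSL, Matrix.one_apply]
    rw [coe_blockInclusion, Matrix.submatrix_apply, Matrix.kroneckerMap_apply, h4, Matrix.one_apply]
    change (if (e v).1 = (g : Equiv.Perm W) (e w).1 then (1 : F) else 0) *
      (if (e v).2 = (e w).2 then 1 else 0) = _
    by_cases c1 : (e v).1 = (g : Equiv.Perm W) (e w).1 <;> by_cases c2 : (e v).2 = (e w).2 <;>
      simp [c1, c2]
  have hτ : ∀ (w : Fin (n + 2) → Fin d) (a : Fin 2), u a = pre w →
      τ (spine hd n (a, w (Fin.last (n + 1)))) = w := by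
    intro w a haw
    rw [← e.apply_eq_iff_eq]
    have h1 : ∀ v, e (τ v) = ((g : Equiv.Perm W) (e v).1, (e v).2) := by
      intro v
      exact e.apply_symm_apply _
    rw [h1]
    have h4 : (e (spine hd n (a, w (Fin.last (n + 1))))).1 = base a := by
      funext k
      have hk := k.2
      change spine hd n (a, w (Fin.last (n + 1))) (Fin.castLE (Nat.le_succ (n + 1)) k) = base a k
      rw [spine_apply]
      simp only [base, Fin.val_castLE]
      split_ifs
      · rfl
      · rfl
      · omega
    rw [h4, hg, haw]
    refine Prod.ext rfl ?_
    funext k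
    have hk : (k : Fin (n + 2)) = Fin.last (n + 1) := by
      apply Fin.ext
      have h5 := k.2
      have h6 := k.1.2
      simp only [Fin.val_last]
      omega
    change spine hd n (a, w (Fin.last (n + 1))) k = w k
    rw [hk, spine_apply, Fin.val_last, if_neg (by omega), if_neg (by omega)]
  refine ⟨(spine hd n).trans τ.toEmbedding, ⟨_, hτ y a ha⟩, ⟨_, hτ z a' ha'⟩, fun A => ?_⟩
  rw [← conj_extend (spine hd n) τ _ hP A]
  exact Subgroup.subset_closure ⟨P, A, rfl⟩

theorem commutator_aux (F : Type*) [Field F] {d : ℕ} (hd : 4 ≤ d) (m n : ℕ) (h : m < n)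
    (b c : Matrix.SpecialLinearGroup (Fin 2 × Fin d) F) :
    Commute (blockInclusion F (Fin d) (show m + 2 ≤ n + 2 by omega) (extend (spine hd m) b))
      (extend (spine hd n) c) := by
  apply slExt
  rw [Matrix.SpecialLinearGroup.coe_mul, Matrix.SpecialLinearGroup.coe_mul]
  refine SupportedIn.commute
    (T := {w | (w ⟨m, by omega⟩ : ℕ) < 2}) (U := Set.range (spine hd n)) ?_ ?_ ?_
  · rw [Set.disjoint_left]
    rintro _ hw ⟨p, rfl⟩
    rw [Set.mem_ofPred_eq, spine_apply, if_pos h] at hw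
    simp only at hw
    omega
  · intro u v huv
    have hr : ∀ w : Fin (n + 2) → Fin d, ¬ (w ⟨m, by omega⟩ : ℕ) < 2 →
        (fun k : Fin (m + 2) => w (Fin.castLE (by omega) k)) ∉ Set.range (spine hd m) := by
      rintro w hw ⟨p, hp⟩
      have h1 := congrArg Fin.val (congrFun hp ⟨m, by omega⟩)
      rw [spine_apply, if_neg (lt_irrefl m), if_pos rfl] at h1
      simp only [Fin.val_castLE, Fin.castLE_mk] at h1
      have := p.1.2
      omega
    rw [blockInclusion_apply, extend_apply_of_notMem _ _ _ _ (huv.imp (hr u) (hr v))]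
    simp only [Matrix.one_apply]
    by_cases e : u = v
    · subst e
      simp
    · rw [if_neg e]
      split_ifs with h1 h2
      · exfalso
        apply e
        funext k
        by_cases hk : (k : ℕ) < m + 2
        · exact congrFun h2 ⟨k, hk⟩
        · exact h1 k (not_lt.1 hk)
      · rfl
      · rfl
  · intro u v huv
    exact extend_apply_of_notMem _ _ _ _ huv

end WordMatrix

open WordMatrix in
/-- The telescope `SL_d(F)`: its groups are `Ω_n = SL_{X^n}(F)` for `n ≥ 1`, its transition maps are
the block diagonal inclusions, `B = SL_{{x_1, x_2} × X}(F) ≅ SL_{2d}(F)`, and `φ_n : B → Ω_n` is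
induced by the injection `u ↦ x_d^{n-2} u` for `n ≥ 2`. -/
noncomputable def slTelescope (d : ℕ) (hd : 4 ≤ d) (F : Type*) [Field F] :
    Telescope (Matrix.SpecialLinearGroup (Fin 2 × Fin d) F) where
  Ω := fun i => Matrix.SpecialLinearGroup (Fin (i + 1) → Fin d) F
  ι := fun _ _ h => blockInclusion F (Fin d) (Nat.succ_le_succ h)
  ι_refl := fun _ ω => blockInclusion_refl ω
  ι_trans := fun _ _ _ hij hjk ω =>
    blockInclusion_trans (Nat.succ_le_succ hij) (Nat.succ_le_succ hjk) ω
  φ := fun i => extend (spine hd i)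
  generation := fun i => generation_aux F hd i
  commutator := fun i j hij b c => commutator_aux F hd i j hij b c

/-- The telescope `PSL_d(F)`: the quotient of the telescope `SL_d(F)` by the centers of its
groups, so that its groups are `Ω_n / Z(Ω_n) = PSL_{X^n}(F)`. -/
noncomputable def pslTelescope (d : ℕ) (hd : 4 ≤ d) (F : Type*) [Field F] :
    Telescope (Matrix.SpecialLinearGroup (Fin 2 × Fin d) F) :=
  (slTelescope d hd F).quotient
    (fun i => Subgroup.center (Matrix.SpecialLinearGroup (Fin (i + 1) → Fin d) F))
    (hN := fun _ => Subgroup.instNormalCenter)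
    (fun _ _ h => WordMatrix.blockInclusion_center (Nat.succ_le_succ h))

/-! A nontrivial normal subgroup of the head pulls back to a subgroup `K` of the product of the
groups SL that is normalized by the huge group, contains the direct sum, and contains an element `g`
of the huge group with infinitely many non-central coordinates. It suffices that such a `K` contains
the huge group (`isSimpleGroup_head_quotient`).

Elements of the huge group are rigid away from the spine (`Tame`): each coordinate is obtained from
the previous one as A ↦ A ⊗ 1, except at active words, which from some position on read x_d … x_d,
then x_1 or x_2, then one arbitrary letter. Since d ≥ 4, the letter x_3 is off the spine. Hence for
an elementary matrix t at words ending in x_3 and N large, the commutator of g with Δ_N(t) is Δ_N of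
the commutator [g_N, t], and it lies in `K`. If all [g_N, t] were central, each g_N would commute
with each t, and coherence would make g_N scalar for all large N (`CoherentFrom.mem_center`). So `K`
contains Δ_N(A) for some non-central A, and normal generation in SL puts every Δ_j(Ω_j) into `K`
(`deltaComap_eq_top`).

It remains to treat b̃. Its first factor is already in `K`, and the rest is supported at words
beginning with x_d. An even permutation of the first letter moves that support to words beginning
with x_3, so modulo `K` any b̃ and c̃ commute (`exists_commute_conj_tail`). As B is perfect, all b̃
lie in `K` (`hugeGroup_le_of_delta_mem`). -/

namespace WordMatrix

/-! ### Elementary matrices and normal subgroups of SL. -/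

section SpecialLinear

variable {Z F : Type*} [Fintype Z] [DecidableEq Z] [Field F]

open Matrix.SpecialLinearGroup (transvection transvection_coe)

/-- The Steinberg relation; it yields both perfectness and the spreading of elementary matrices
inside a normal subgroup. -/
theorem commutator_transvection {a b c : Z} (hab : a ≠ b) (hbc : b ≠ c) (hac : a ≠ c) (x y : F) :
    transvection hab x * transvection hbc y * (transvection hab x)⁻¹ * (transvection hbc y)⁻¹ =
      transvection hac (x * y) := by
  rw [mul_inv_eq_iff_eq_mul, mul_inv_eq_iff_eq_mul]
  apply slExt
  simp only [Matrix.SpecialLinearGroup.coe_mul, transvection_coe]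
  simp only [mul_add, add_mul, one_mul, mul_one, single_mul_single_same,
    single_mul_single_of_ne _ _ _ _ hac.symm, single_mul_single_of_ne _ _ _ _ hbc.symm, add_zero]
  abel

/-- The special linear group over a field is generated by the elementary matrices. -/
theorem eq_top_of_forall_transvection_mem (H : Subgroup (Matrix.SpecialLinearGroup Z F))
    (hT : ∀ (y z : Z) (h : y ≠ z) (c : F), transvection h c ∈ H) : H = ⊤ := by
  -- Two indices at a time suffice, and SL_2 over a field is generated by elementary matrices; this
  -- absorbs the diagonal generators.
  refine eq_top_of_extend_mem (Y := Fin 2) H fun y z hyz => ?_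
  let f : Fin 2 ↪ Z := ⟨![y, z], by
    intro i j hij
    fin_cases i <;> fin_cases j <;> simp_all [eq_comm]⟩
  refine ⟨f, ⟨0, rfl⟩, ⟨1, rfl⟩, fun A => ?_⟩
  refine Matrix.SL2.transvection_induction (fun A => extend f A ∈ H) ?_ ?_ A
  · intro i j hij c
    rw [extend_transvection]
    exact hT _ _ _ _
  · intro A A' hA hA'
    rw [map_mul]
    exact mul_mem hA hA'

/-- A subgroup containing all commutators is everything, as soon as there are three indices. -/
theorem eq_top_of_commutator_mem (hZ : 3 ≤ Fintype.card Z)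
    (H : Subgroup (Matrix.SpecialLinearGroup Z F)) (hH : ∀ g h, g * h * g⁻¹ * h⁻¹ ∈ H) : H = ⊤ := by
  refine eq_top_of_forall_transvection_mem H fun y z hyz c => ?_
  obtain ⟨x, hx⟩ : ∃ x, x ∉ ({y, z} : Finset Z) := by
    by_contra! h
    have := Finset.card_le_card (fun x _ => h x : (Finset.univ : Finset Z) ⊆ {y, z})
    have := Finset.card_le_two (a := y) (b := z)
    rw [Finset.card_univ] at *
    omega
  simp only [Finset.mem_insert, Finset.mem_singleton, not_or] at hx
  have := commutator_transvection (F := F) (Ne.symm hx.1) hx.2 hyz c 1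
  rw [mul_one] at this
  rw [← this]
  exact hH _ _

/-- A normal subgroup containing a non-trivial elementary matrix is everything, as soon as there
are three indices. -/
theorem eq_top_of_transvection_mem_normal (hZ : 3 ≤ Fintype.card Z)
    (H : Subgroup (Matrix.SpecialLinearGroup Z F)) [H.Normal] {a b : Z} (hab : a ≠ b) {c : F}
    (hc : c ≠ 0) (h : transvection hab c ∈ H) : H = ⊤ := by
  have third : ∀ y z : Z, ∃ x, x ≠ y ∧ x ≠ z := by
    intro y z
    by_contra! h
    have h1 := Finset.card_le_card (fun x _ => by
      simp only [Finset.mem_insert, Finset.mem_singleton]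
      exact or_iff_not_imp_left.2 (h x) : (Finset.univ : Finset Z) ⊆ {y, z})
    have := Finset.card_le_two (a := y) (b := z)
    rw [Finset.card_univ] at h1
    omega
  have comm : ∀ g k, g ∈ H ∨ k ∈ H → g * k * g⁻¹ * k⁻¹ ∈ H := by
    rintro g k (hg | hk)
    · have := mul_mem hg (Subgroup.Normal.conj_mem ‹_› _ (inv_mem hg) k)
      simpa [mul_assoc] using this
    · exact mul_mem (Subgroup.Normal.conj_mem ‹_› _ hk g) (inv_mem hk)
  let P : Z → Z → Prop := fun y z => ∃ (h : y ≠ z) (c : F), c ≠ 0 ∧ transvection h c ∈ H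
  -- One nonzero parameter at (y, z) gives every parameter at (y, x), since it can be divided out in
  -- the Steinberg relation.
  have right : ∀ {y z x}, P y z → ∀ (hxy : y ≠ x), z ≠ x → ∀ c, transvection (F := F) hxy c ∈ H := by
    rintro y z x ⟨hyz, e, he, hm⟩ hyx hzx c
    have := commutator_transvection (F := F) hyz hzx hyx e (e⁻¹ * c)
    rw [mul_inv_cancel_left₀ he] at this
    rw [← this]
    exact comm _ _ (Or.inl hm)
  have left : ∀ {y z x}, P y z → ∀ (hxz : x ≠ z), x ≠ y → ∀ c, transvection (F := F) hxz c ∈ H := by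
    rintro y z x ⟨hyz, e, he, hm⟩ hxz hxy c
    have := commutator_transvection (F := F) hxy hyz hxz (c * e⁻¹) e
    rw [inv_mul_cancel_right₀ he] at this
    rw [← this]
    exact comm _ _ (Or.inr hm)
  have right' : ∀ {y z x}, P y z → y ≠ x → P y x := by
    intro y z x hP hyx
    by_cases hzx : z = x
    · exact hzx ▸ hP
    · exact ⟨hyx, 1, one_ne_zero, right hP hyx hzx 1⟩
  have left' : ∀ {y z x}, P y z → x ≠ z → P x z := by
    intro y z x hP hxz
    by_cases hxy : x = y
    · exact hxy ▸ hP
    · exact ⟨hxz, 1, one_ne_zero, left hP hxz hxy 1⟩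
  refine eq_top_of_forall_transvection_mem H fun p q hpq e => ?_
  -- Positions travel (a, b) → (a, s) → (p, s) → (p, r) → (p, q). The detour through `r` makes the
  -- last step a genuine change of column, which is what produces an arbitrary parameter `e`.
  obtain ⟨r, hrp, hrq⟩ := third p q
  obtain ⟨s, hsa, hsp⟩ := third a p
  have h1 : P a s := right' ⟨hab, c, hc, h⟩ hsa.symm
  exact right (right' (left' h1 hsp.symm) hrp.symm) hpq hrq e

/-- A normal subgroup containing a non-trivial matrix that fixes two of the basis vectors, and the
corresponding coordinates, is everything. -/
theorem eq_top_of_supportedIn_mem (hZ : 3 ≤ Fintype.card Z)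
    (H : Subgroup (Matrix.SpecialLinearGroup Z F)) [hH : H.Normal] {T : Set Z} {r r' : Z}
    (hr : r ∉ T) (hr' : r' ∉ T) (hrr' : r' ≠ r) {C : Matrix.SpecialLinearGroup Z F} (hC : C ∈ H)
    (hC1 : C ≠ 1) (hCT : SupportedIn T (C : Matrix Z Z F)) : H = ⊤ := by
  obtain ⟨p, q, hpq⟩ : ∃ p q, (C : Matrix Z Z F) p q ≠ (1 : Matrix Z Z F) p q := by
    by_contra! h
    exact hC1 (slExt (Matrix.ext h))
  have hp : p ∈ T := by
    by_contra hp
    exact hpq (hCT p q (Or.inl hp))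
  have hq : q ∈ T := by
    by_contra hq
    exact hpq (hCT p q (Or.inr hq))
  have hqr : q ≠ r := fun e => hr (e ▸ hq)
  have hr'p : r' ≠ p := fun e => hr' (e ▸ hp)
  -- Two commutators isolate one entry of C - 1. Since row `r` of `C` is trivial, [C, 1 + E] = 1 +
  -- (C - 1)E, which carries column `q` of C - 1 into column `r`. The commutator of 1 + E' with this
  -- keeps only its entry in row `p` and moves it to (r', r).
  set E : Matrix Z Z F := single q r 1 with hE
  set E' : Matrix Z Z F := single r' p 1 with hE'
  have hEC : E * (C : Matrix Z Z F) = E := by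
    ext u v
    by_cases hu : u = q
    · subst hu
      rw [hE, single_mul_apply_same, one_mul, hCT r v (Or.inl hr), Matrix.one_apply,
        single_apply]
      simp
    · rw [hE, single_mul_apply_of_ne _ _ _ _ _ hu, single_apply, if_neg]
      exact fun h => hu h.1.symm
  have hEE : E * E = 0 := by rw [hE, single_mul_single_of_ne _ _ _ _ hqr.symm]
  have hEE' : E * E' = 0 := by rw [hE, hE', single_mul_single_of_ne _ _ _ _ hrr'.symm]
  set t := transvection (F := F) hqr 1
  set t' := transvection (F := F) hr'p 1
  have ht : (t : Matrix Z Z F) = 1 + E := transvection_coe _ _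
  have ht' : (t' : Matrix Z Z F) = 1 + E' := transvection_coe _ _
  set D := C * t * C⁻¹ * t⁻¹ with hD
  have hDH : D ∈ H := by
    have := mul_mem hC (hH.conj_mem _ (inv_mem hC) t)
    simpa [hD, mul_assoc] using this
  set W : Matrix Z Z F := ((C : Matrix Z Z F) - 1) * E with hW
  have hDW : (D : Matrix Z Z F) = 1 + W := by
    have h1 : D * (t * C) = C * t := by rw [hD]; group
    have h2 : (1 + W) * ((t * C : Matrix.SpecialLinearGroup Z F) : Matrix Z Z F) =
        (C * t : Matrix.SpecialLinearGroup Z F) := by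
      rw [Matrix.SpecialLinearGroup.coe_mul, Matrix.SpecialLinearGroup.coe_mul, ht, hW,
        ← mul_assoc]
      have : (1 + ((C : Matrix Z Z F) - 1) * E) * (1 + E) = 1 + C * E := by
        rw [mul_add, mul_one, add_mul, one_mul, mul_assoc, hEE, mul_zero, sub_mul, one_mul]
        abel
      rw [this, add_mul, one_mul, mul_assoc, hEC, mul_add, mul_one]
    have h3 : ∀ X : Matrix Z Z F,
        X * ((t * C : Matrix.SpecialLinearGroup Z F) : Matrix Z Z F) *
          ((t * C)⁻¹ : Matrix.SpecialLinearGroup Z F) = X := by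
      intro X
      rw [mul_assoc, ← Matrix.SpecialLinearGroup.coe_mul, mul_inv_cancel,
        Matrix.SpecialLinearGroup.coe_one, mul_one]
    rw [← h3 (1 + W), h2, ← h1, Matrix.SpecialLinearGroup.coe_mul D (t * C), h3]
  have hWE' : W * E' = 0 := by rw [hW, mul_assoc, hEE', mul_zero]
  have hEW : E * W = 0 := by
    rw [hW, ← mul_assoc, mul_sub, hEC, mul_one, sub_self, zero_mul]
  have hWW : W * W = 0 := by rw [hW, mul_assoc, ← hW, hEW, mul_zero]
  set c : F := ((C : Matrix Z Z F) - 1) p q with hc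
  have hc0 : c ≠ 0 := sub_ne_zero.2 hpq
  have hE'W : E' * W = single r' r c := by
    rw [hW, ← mul_assoc, hE', hE, hc]
    ext u v
    by_cases hv : v = r
    · subst hv
      rw [mul_single_apply_same, mul_one]
      by_cases hu : u = r'
      · subst hu
        rw [single_mul_apply_same, one_mul, single_apply_same]
      · rw [single_mul_apply_of_ne _ _ _ _ _ hu, single_apply, if_neg]
        exact fun h => hu h.1.symm
    · rw [mul_single_apply_of_ne _ _ _ _ _ hv, single_apply, if_neg]
      exact fun h => hv h.2.symm
  have hE'E' : E' * E' = 0 := by rw [hE', single_mul_single_of_ne _ _ _ _ hr'p.symm]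
  have key : t' * D * t'⁻¹ * D⁻¹ = transvection hrr' c := by
    rw [mul_inv_eq_iff_eq_mul, mul_inv_eq_iff_eq_mul]
    apply slExt
    simp only [Matrix.SpecialLinearGroup.coe_mul]
    rw [ht', hDW, transvection_coe, ← hE'W]
    have h1 : (1 + E' * W) * (1 + W) * (1 + E') =
        1 + W + E' + E' * W + W * E' + E' * (W * W) + E' * (W * E') + E' * (W * W) * E' := by
      noncomm_ring
    rw [h1, hWW, hWE']
    noncomm_ring
  apply eq_top_of_transvection_mem_normal hZ H hrr' hc0
  rw [← key]
  exact mul_mem (hH.conj_mem _ hDH _) (inv_mem hDH)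

/-- A matrix that commutes with an elementary matrix up to a scalar commutes with it. -/
theorem commute_single_of_commutator_mem_center {A : Matrix.SpecialLinearGroup Z F} {w w' : Z}
    (h : w ≠ w')
    (hA : A * transvection h 1 * A⁻¹ * (transvection h 1)⁻¹ ∈
      Subgroup.center (Matrix.SpecialLinearGroup Z F)) :
    Commute (single w w' (1 : F)) (A : Matrix Z Z F) := by
  obtain ⟨l, -, hl⟩ := Matrix.SpecialLinearGroup.mem_center_iff.1 hA
  set E : Matrix Z Z F := single w w' 1 with hE
  set K := A * transvection h 1 * A⁻¹ * (transvection h 1)⁻¹ with hK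
  have hEE : E * E = 0 := by rw [hE, single_mul_single_of_ne _ _ _ _ h.symm]
  have h1 : A * transvection h 1 = K * transvection h 1 * A := by rw [hK]; group
  have h2 := congrArg (fun X : Matrix.SpecialLinearGroup Z F => (X : Matrix Z Z F)) h1
  simp only [Matrix.SpecialLinearGroup.coe_mul] at h2
  rw [transvection_coe, ← hl, ← hE] at h2
  have hs : scalar Z l = l • (1 : Matrix Z Z F) := by
    rw [smul_one_eq_diagonal]; rfl
  rw [hs] at h2
  have hinv : (A : Matrix Z Z F) * (A⁻¹ : Matrix.SpecialLinearGroup Z F) = 1 := by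
    rw [← Matrix.SpecialLinearGroup.coe_mul, mul_inv_cancel, Matrix.SpecialLinearGroup.coe_one]
  have hinv' : ((A⁻¹ : Matrix.SpecialLinearGroup Z F) : Matrix Z Z F) * A = 1 := by
    rw [← Matrix.SpecialLinearGroup.coe_mul, inv_mul_cancel, Matrix.SpecialLinearGroup.coe_one]
  -- The left side squares to zero because `E` does, while the square of the right side is (l - 1)²
  -- plus a multiple of `E`. The diagonal entry at `w` then forces l = 1.
  have h3 : (A : Matrix Z Z F) * E * (A⁻¹ : Matrix.SpecialLinearGroup Z F) =
      (l - 1) • (1 : Matrix Z Z F) + l • E := by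
    have h4 := congrArg (fun X => X * ((A⁻¹ : Matrix.SpecialLinearGroup Z F) : Matrix Z Z F)) h2
    simp only [mul_add, mul_one, add_mul, smul_mul_assoc, one_mul, mul_assoc, hinv] at h4
    rw [mul_assoc, sub_smul, one_smul, eq_sub_of_add_eq' h4]
    abel
  have h5 : ((A : Matrix Z Z F) * E * (A⁻¹ : Matrix.SpecialLinearGroup Z F)) *
      ((A : Matrix Z Z F) * E * (A⁻¹ : Matrix.SpecialLinearGroup Z F)) = 0 := by
    calc _ = (A : Matrix Z Z F) * (E * (((A⁻¹ : Matrix.SpecialLinearGroup Z F) : Matrix Z Z F) *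
          (A : Matrix Z Z F)) * E) * (A⁻¹ : Matrix.SpecialLinearGroup Z F) := by
            simp only [mul_assoc]
      _ = 0 := by rw [hinv', mul_one, hEE, mul_zero, zero_mul]
  rw [h3] at h5
  have h6 := congrFun (congrFun h5 w) w
  have hl1 : l = 1 := by
    simp only [mul_add, add_mul, smul_mul_assoc, mul_smul_comm, one_mul, mul_one, hEE, smul_zero,
      add_zero, Matrix.add_apply, Matrix.smul_apply, Matrix.one_apply_eq, Matrix.zero_apply] at h6
    rw [hE, single_apply, if_neg (fun e => h e.2.symm)] at h6
    simp only [smul_eq_mul, mul_zero, add_zero, mul_one] at h6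
    exact sub_eq_zero.1 (mul_self_eq_zero.1 h6)
  rw [hl1, one_smul, one_mul, mul_add, mul_one, add_mul, one_mul] at h2
  exact (add_left_cancel h2).symm

end SpecialLinear

end WordMatrix

namespace Telescope

/-! ### Formal properties of huge groups. -/

section General

variable {B : Type*} [Group B] (S : Telescope B)

theorem delta_mul (i : ℕ) (a b : S.Ω i) : S.delta i (a * b) = S.delta i a * S.delta i b := by
  funext j
  simp only [delta, Pi.mul_apply]
  split_ifs <;> simp

/-- `Δ_i` as a homomorphism. -/
def deltaHom (i : ℕ) : S.Ω i →* ∀ j, S.Ω j := MonoidHom.mk' (S.delta i) (S.delta_mul i)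

theorem deltaHom_apply (i : ℕ) (a : S.Ω i) : S.deltaHom i a = S.delta i a := rfl

theorem delta_apply {i j : ℕ} (h : i ≤ j) (a : S.Ω i) : S.delta i a j = S.ι i j h a :=
  dif_pos h

theorem delta_apply_of_lt {i j : ℕ} (h : j < i) (a : S.Ω i) : S.delta i a j = 1 :=
  dif_neg (not_le.2 h)

theorem delta_mem_hugeGroup (i : ℕ) (a : S.Ω i) : S.delta i a ∈ S.hugeGroup :=
  Subgroup.subset_closure (Or.inl (Set.mem_iUnion.2 ⟨i, a, rfl⟩))

theorem tilde_mem_hugeGroup (b : B) : S.tilde b ∈ S.hugeGroup :=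
  Subgroup.subset_closure (Or.inr ⟨b, rfl⟩)

/-- Modulo the direct sum, `Δ_i` and `Δ_{i+1}` agree on `Ω_i`. -/
theorem delta_succ_mem_iff {K : Subgroup (∀ j, S.Ω j)} (hK : S.directSum ≤ K) (i : ℕ) (a : S.Ω i) :
    S.delta (i + 1) (S.ι i (i + 1) i.le_succ a) ∈ K ↔ S.delta i a ∈ K := by
  have h : S.delta i a * (S.delta (i + 1) (S.ι i (i + 1) i.le_succ a))⁻¹ ∈ K := by
    apply hK
    refine Set.Finite.subset (Set.finite_Iic i) fun j hj => ?_
    by_contra h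
    have h' : i < j := not_le.1 h
    exact hj (by
      rw [Pi.mul_apply, Pi.inv_apply, S.delta_apply h'.le, S.delta_apply h', S.ι_trans,
        mul_inv_cancel])
  rw [← Subgroup.mul_mem_cancel_left K h, inv_mul_cancel_right]

theorem tilde_zero (b : B) : S.tilde b 0 = 1 := rfl

/-- Trades the ordered product for a recursion in the coordinate. -/
theorem tilde_succ (b : B) (j : ℕ) :
    S.tilde b (j + 1) = S.ι j (j + 1) j.le_succ (S.tilde b j) * S.φ j b := by
  have h : ∀ i (hi : i < j), S.ι (i + 1) (j + 1) (Nat.lt_succ_of_lt hi) (S.φ i b) =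
      S.ι j (j + 1) j.le_succ (S.ι (i + 1) j hi (S.φ i b)) := fun i hi => by rw [S.ι_trans]
  simp only [tilde]
  rw [List.ofFn_succ', List.prod_concat, map_list_prod, List.map_ofFn]
  congr 1
  · congr 2
    funext i
    exact h i i.2
  · exact S.ι_refl _ _

theorem commute_tilde (i j : ℕ) (h : i ≤ j) (b c : B) :
    Commute (S.ι i (j + 1) (Nat.le_succ_of_le h) (S.tilde b i)) (S.φ j c) := by
  induction i with
  | zero => rw [tilde_zero, map_one]; exact Commute.one_left _
  | succ i ih =>
    rw [tilde_succ, map_mul, S.ι_trans]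
    exact (ih (Nat.le_of_succ_le h)).mul_left (S.commutator i j h b c)

theorem tilde_mul (b c : B) : S.tilde (b * c) = S.tilde b * S.tilde c := by
  funext j
  induction j with
  | zero => simp [tilde_zero]
  | succ j ih =>
    rw [Pi.mul_apply, tilde_succ, tilde_succ, tilde_succ, ih, Pi.mul_apply, map_mul, map_mul]
    exact (S.commute_tilde j j le_rfl c b).mul_mul_mul_comm _ _

/-- `b ↦ b̃` as a homomorphism. -/
def tildeHom : B →* ∀ j, S.Ω j := MonoidHom.mk' S.tilde S.tilde_mul

/-- No inverse case is needed, because the generators are images of homomorphisms and hence closed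
under inverses. This matters since tameness is only shown to be stable under products. -/
theorem hugeGroup_induction {p : (∀ j, S.Ω j) → Prop} (hΔ : ∀ i a, p (S.delta i a))
    (hb : ∀ b, p (S.tilde b)) (hmul : ∀ f g, p f → p g → p (f * g)) {g : ∀ j, S.Ω j}
    (hg : g ∈ S.hugeGroup) : p g := by
  have h : ((⋃ i, Set.range (S.delta i)) ∪ Set.range S.tilde)⁻¹ ⊆
      (⋃ i, Set.range (S.delta i)) ∪ Set.range S.tilde := by
    rintro x (hx | ⟨b, hx⟩)
    · obtain ⟨i, a, hx⟩ := Set.mem_iUnion.1 hx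
      refine Or.inl (Set.mem_iUnion.2 ⟨i, a⁻¹, ?_⟩)
      rw [← inv_inv x, ← hx]
      exact map_inv (S.deltaHom i) a
    · refine Or.inr ⟨b⁻¹, ?_⟩
      rw [← inv_inv x, ← hx]
      exact map_inv S.tildeHom b
  rw [hugeGroup, ← Subgroup.mem_toSubmonoid, Subgroup.closure_toSubmonoid,
    Set.union_eq_self_of_subset_right h] at hg
  induction hg using Submonoid.closure_induction with
  | mem x hx =>
    rcases hx with hx | ⟨b, rfl⟩
    · obtain ⟨i, a, rfl⟩ := Set.mem_iUnion.1 hx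
      exact hΔ i a
    · exact hb b
  | one => exact map_one (S.deltaHom 0) ▸ hΔ 0 1
  | mul x y _ _ hx hy => exact hmul x y hx hy

/-! ### Subgroups normalized by the huge group. -/

section NormalSubgroup

variable {K : Subgroup (∀ j, S.Ω j)}

/-- The elements `ω` of `Ω_j` with `Δ_j(ω) ∈ K`. -/
def deltaComap (K : Subgroup (∀ j, S.Ω j)) (j : ℕ) : Subgroup (S.Ω j) := K.comap (S.deltaHom j)

theorem deltaComap_normal (hK : ∀ g ∈ S.hugeGroup, ∀ k ∈ K, g * k * g⁻¹ ∈ K) (j : ℕ) :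
    (S.deltaComap K j).Normal where
  conj_mem a ha g := by
    have := hK _ (S.delta_mem_hugeGroup j g) _ ha
    rw [deltaComap, Subgroup.mem_comap, map_mul, map_mul, map_inv]
    exact this

/-- If `g` conjugates `Δ_N(t)` coordinatewise into `Δ_N(Ω_N)`, then `K` contains `Δ_N` of the
commutator of the coordinate of `g` at `N` with `t`. -/
theorem commutator_mem_deltaComap (hK : ∀ g ∈ S.hugeGroup, ∀ k ∈ K, g * k * g⁻¹ ∈ K)
    {g : ∀ j, S.Ω j} (hg : g ∈ K) {N : ℕ} {t : S.Ω N}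
    (h : ∀ j (hj : N ≤ j), g j * S.ι N j hj t * (g j)⁻¹ = S.ι N j hj (g N * t * (g N)⁻¹)) :
    g N * t * (g N)⁻¹ * t⁻¹ ∈ S.deltaComap K N := by
  have h1 : S.deltaHom N (g N * t * (g N)⁻¹) = g * S.deltaHom N t * g⁻¹ := by
    funext j
    rw [Pi.mul_apply, Pi.mul_apply, Pi.inv_apply, deltaHom_apply, deltaHom_apply]
    by_cases hj : N ≤ j
    · rw [S.delta_apply hj, S.delta_apply hj, h j hj]
    · rw [S.delta_apply_of_lt (not_le.1 hj), S.delta_apply_of_lt (not_le.1 hj), mul_one,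
        mul_inv_cancel]
  -- Bracketed as g · (t g⁻¹ t⁻¹), the commutator is `g` times a conjugate of g⁻¹ by an element of
  -- the huge group.
  rw [deltaComap, Subgroup.mem_comap, map_mul, map_inv, h1, mul_assoc, mul_assoc,
    ← mul_assoc (S.deltaHom N t)]
  exact mul_mem hg (hK _ (S.delta_mem_hugeGroup N t) _ (inv_mem hg))

/-- `b̃` without its first factor. -/
def tail (b : B) : ∀ j, S.Ω j := (S.delta 1 (S.φ 0 b))⁻¹ * S.tilde b

theorem tail_zero (b : B) : S.tail b 0 = 1 := by
  rw [tail, Pi.mul_apply, Pi.inv_apply, delta_apply_of_lt _ Nat.zero_lt_one, tilde_zero, inv_one,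
    one_mul]

theorem tail_one (b : B) : S.tail b 1 = 1 := by
  rw [tail, Pi.mul_apply, Pi.inv_apply, delta_apply _ le_rfl, ι_refl, tilde_succ, tilde_zero,
    map_one, one_mul, inv_mul_cancel]

/-- The recursion of b̃, restarted from 1 at coordinate 1: only the factors `φ j` with j ≥ 1 remain,
which in the word telescopes are those whose spine begins with x_d. -/
theorem tail_succ (b : B) (j : ℕ) :
    S.tail b (j + 2) = S.ι (j + 1) (j + 2) (j + 1).le_succ (S.tail b (j + 1)) * S.φ (j + 1) b := by
  simp only [tail, Pi.mul_apply, Pi.inv_apply]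
  rw [S.delta_apply (show 1 ≤ j + 2 by omega), S.delta_apply (show 1 ≤ j + 1 by omega),
    S.tilde_succ b (j + 1), map_mul, map_inv, S.ι_trans, mul_assoc]

/-- Modulo `N` the factors `a`, `b`, `p` disappear, and the hypothesis says that `x` and `y`
commute. -/
theorem _root_.commutator_mem_of_commute_conj {G : Type*} [Group G] {N : Subgroup G} [N.Normal]
    {x y a b p : G} (ha : a ∈ N) (hb : b ∈ N) (hp : p ∈ N)
    (h : Commute x (p * y * p⁻¹)) : (a * x) * (b * y) * (a * x)⁻¹ * (b * y)⁻¹ ∈ N := by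
  rw [← QuotientGroup.eq_one_iff] at ha hb hp ⊢
  have h' := congrArg (QuotientGroup.mk (s := N)) h.eq
  simp only [QuotientGroup.mk_mul, QuotientGroup.mk_inv, ha, hb, hp, one_mul, inv_one,
    mul_one] at h' ⊢
  rw [h']
  group

theorem commutator_tilde_mem (hK : ∀ g ∈ S.hugeGroup, ∀ k ∈ K, g * k * g⁻¹ ∈ K)
    (hΔ : ∀ i a, S.delta i a ∈ K) {b c : B} {a : S.Ω 0}
    (h : Commute (S.tail b) (S.delta 0 a * S.tail c * (S.delta 0 a)⁻¹)) :
    S.tilde b * S.tilde c * (S.tilde b)⁻¹ * (S.tilde c)⁻¹ ∈ K := by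
  have hn : (K.subgroupOf S.hugeGroup).Normal := ⟨fun k hk g => hK g g.2 k hk⟩
  have htail : ∀ b, S.tail b ∈ S.hugeGroup := fun b =>
    mul_mem (inv_mem (S.delta_mem_hugeGroup _ _)) (S.tilde_mem_hugeGroup b)
  have hfac : ∀ b, S.tilde b = S.delta 1 (S.φ 0 b) * S.tail b := fun b =>
    (mul_inv_cancel_left _ _).symm
  have := commutator_mem_of_commute_conj (N := K.subgroupOf S.hugeGroup)
    (x := ⟨_, htail b⟩) (y := ⟨_, htail c⟩)
    (a := ⟨_, S.delta_mem_hugeGroup 1 (S.φ 0 b)⟩) (b := ⟨_, S.delta_mem_hugeGroup 1 (S.φ 0 c)⟩)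
    (p := ⟨_, S.delta_mem_hugeGroup 0 a⟩) (hΔ _ _) (hΔ _ _) (hΔ 0 a) (Subtype.ext h)
  rw [hfac b, hfac c]
  exact this

/-- If all commutators of elements of `B` generate `B`, it suffices to check that `K` contains the
images of the groups `Ω_i`, and that tails commute up to conjugation by these. -/
theorem hugeGroup_le_of_delta_mem (hK : ∀ g ∈ S.hugeGroup, ∀ k ∈ K, g * k * g⁻¹ ∈ K)
    (hΔ : ∀ i a, S.delta i a ∈ K)
    (hB : ∀ H : Subgroup B, (∀ g h, g * h * g⁻¹ * h⁻¹ ∈ H) → H = ⊤)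
    (h : ∀ b c, ∃ a, ∀ j, Commute (S.tail b j)
      (S.ι 0 j j.zero_le a * S.tail c j * (S.ι 0 j j.zero_le a)⁻¹)) :
    S.hugeGroup ≤ K := by
  have htop : K.comap S.tildeHom = ⊤ := by
    refine hB _ fun b c => ?_
    obtain ⟨a, ha⟩ := h b c
    rw [Subgroup.mem_comap, map_mul, map_mul, map_mul, map_inv, map_inv]
    refine S.commutator_tilde_mem hK hΔ (a := a) (funext fun j => ?_)
    rw [Pi.mul_apply, Pi.mul_apply, Pi.mul_apply, Pi.mul_apply, Pi.inv_apply,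
      S.delta_apply j.zero_le]
    exact ha j
  rw [hugeGroup, Subgroup.closure_le]
  rintro _ (h | ⟨b, rfl⟩)
  · obtain ⟨i, a, rfl⟩ := Set.mem_iUnion.1 h
    exact hΔ i a
  · exact (htop ▸ Subgroup.mem_top b : b ∈ K.comap S.tildeHom)

end NormalSubgroup

/-! ### Transfer between a telescope and its quotient. -/

section Quotient

variable (M : ∀ i, Subgroup (S.Ω i)) [hN : ∀ i, (M i).Normal]
  (hM : ∀ i j (h : i ≤ j), M i ≤ (M j).comap (S.ι i j h))

/-- The coordinatewise projection onto the quotient telescope. -/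
def quotientHom : (∀ j, S.Ω j) →* ∀ j, (S.quotient M hM).Ω j where
  toFun g := fun j => (g j : S.Ω j ⧸ M j)
  map_one' := rfl
  map_mul' _ _ := rfl

theorem quotientHom_apply_eq_one_iff (g : ∀ j, S.Ω j) (j : ℕ) :
    S.quotientHom M hM g j = 1 ↔ g j ∈ M j :=
  QuotientGroup.eq_one_iff (N := M j) (g j)

theorem quotientHom_delta (i : ℕ) (a : S.Ω i) :
    S.quotientHom M hM (S.delta i a) = (S.quotient M hM).delta i (a : S.Ω i ⧸ M i) := by
  funext j
  by_cases h : i ≤ j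
  · exact (congrArg (QuotientGroup.mk (s := M j)) (S.delta_apply h a)).trans
      ((S.quotient M hM).delta_apply h (QuotientGroup.mk (s := M i) a)).symm
  · exact (congrArg (QuotientGroup.mk (s := M j)) (S.delta_apply_of_lt (not_le.1 h) a)).trans
      ((S.quotient M hM).delta_apply_of_lt (not_le.1 h) (QuotientGroup.mk (s := M i) a)).symm

theorem quotientHom_tilde (b : B) :
    S.quotientHom M hM (S.tilde b) = (S.quotient M hM).tilde b := by
  funext j
  induction j with
  | zero => rfl
  | succ j ih =>
    rw [tilde_succ, ← ih]
    change ((S.tilde b (j + 1) : S.Ω (j + 1)) : S.Ω (j + 1) ⧸ M (j + 1)) = _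
    rw [tilde_succ]
    rfl

theorem map_quotientHom_hugeGroup :
    S.hugeGroup.map (S.quotientHom M hM) = (S.quotient M hM).hugeGroup := by
  rw [hugeGroup, hugeGroup, MonoidHom.map_closure, Set.image_union, Set.image_iUnion]
  congr 2
  · refine Set.iUnion_congr fun i => ?_
    ext x
    constructor
    · rintro ⟨_, ⟨a, rfl⟩, rfl⟩
      exact ⟨_, (S.quotientHom_delta M hM i a).symm⟩
    · rintro ⟨a, rfl⟩
      obtain ⟨a, rfl⟩ := QuotientGroup.mk_surjective a
      exact ⟨_, ⟨a, rfl⟩, S.quotientHom_delta M hM i a⟩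
  · ext x
    constructor
    · rintro ⟨_, ⟨a, rfl⟩, rfl⟩
      exact ⟨_, (S.quotientHom_tilde M hM a).symm⟩
    · rintro ⟨a, rfl⟩
      exact ⟨_, ⟨a, rfl⟩, S.quotientHom_tilde M hM a⟩

theorem mem_directSum_quotient_iff (g : ∀ j, S.Ω j) :
    S.quotientHom M hM g ∈ (S.quotient M hM).directSum ↔ {j | g j ∉ M j}.Finite := by
  change {j | S.quotientHom M hM g j ≠ 1}.Finite ↔ _
  simp only [ne_eq, quotientHom_apply_eq_one_iff]

/-- A criterion for the simplicity of the head of a quotient telescope, in terms of subgroups that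
are normalized by the huge group upstairs. -/
theorem isSimpleGroup_head_quotient
    (hne : ∃ g ∈ S.hugeGroup, {j | g j ∉ M j}.Infinite)
    (h : ∀ K : Subgroup (∀ j, S.Ω j), (∀ g ∈ S.hugeGroup, ∀ k ∈ K, g * k * g⁻¹ ∈ K) →
      S.directSum ≤ K → (∃ k ∈ K, k ∈ S.hugeGroup ∧ {j | k j ∉ M j}.Infinite) →
      S.hugeGroup ≤ K) :
    IsSimpleGroup (S.quotient M hM).head := by
  set P := S.quotient M hM
  have hmem : ∀ g ∈ S.hugeGroup, S.quotientHom M hM g ∈ P.hugeGroup := fun g hg =>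
    S.map_quotientHom_hugeGroup M hM ▸ Subgroup.mem_map_of_mem _ hg
  let q : P.hugeGroup →* P.head := QuotientGroup.mk' (P.directSum.subgroupOf P.hugeGroup)
  have hlift : ∀ x : P.head, ∃ g, ∃ hg : g ∈ S.hugeGroup,
      q ⟨S.quotientHom M hM g, hmem g hg⟩ = x := by
    intro x
    obtain ⟨⟨y, hy⟩, rfl⟩ := QuotientGroup.mk'_surjective _ x
    obtain ⟨g, hg, rfl⟩ := (SetLike.ext_iff.1 (S.map_quotientHom_hugeGroup M hM) y).2 hy
    exact ⟨g, hg, rfl⟩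
  have hq : ∀ g (hg : g ∈ S.hugeGroup), q ⟨S.quotientHom M hM g, hmem g hg⟩ = 1 ↔
      {j | g j ∉ M j}.Finite := by
    intro g hg
    rw [← S.mem_directSum_quotient_iff M hM]
    exact (QuotientGroup.eq_one_iff _).trans Subgroup.mem_subgroupOf
  refine { exists_pair_ne := ?_, eq_bot_or_eq_top_of_normal := ?_ }
  · obtain ⟨g, hg, hinf⟩ := hne
    exact ⟨_, 1, fun e => hinf ((hq g hg).1 e)⟩
  · intro N hNn
    rw [or_iff_not_imp_left]
    intro hbot
    -- Pulled back to the full product, `K` also contains families outside the huge group, for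
    -- instance all families with coordinates in the `M j`. This is why the criterion asks
    -- separately for a witness in the huge group.
    let K : Subgroup (∀ j, S.Ω j) :=
      ((N.comap q).map P.hugeGroup.subtype).comap (S.quotientHom M hM)
    have hK : ∀ g, g ∈ K ↔ ∃ hg : S.quotientHom M hM g ∈ P.hugeGroup, q ⟨_, hg⟩ ∈ N := by
      intro g
      constructor
      · rintro ⟨⟨y, hy⟩, hyN, e⟩
        have e' : y = S.quotientHom M hM g := e
        subst e'
        exact ⟨hy, hyN⟩
      · rintro ⟨hy, hyN⟩
        exact ⟨⟨_, hy⟩, hyN, rfl⟩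
    have hle : S.hugeGroup ≤ K := by
      apply h K
      · intro g hg k hk
        obtain ⟨hk1, hk2⟩ := (hK k).1 hk
        refine (hK _).2 ⟨?_, ?_⟩
        · rw [map_mul, map_mul, map_inv]
          exact mul_mem (mul_mem (hmem g hg) hk1) (inv_mem (hmem g hg))
        · have := hNn.conj_mem _ hk2 (q ⟨_, hmem g hg⟩)
          rw [← map_inv, ← map_mul, ← map_mul] at this
          convert this using 2
          apply Subtype.ext
          simp
      · intro g hg
        have hg' := S.directSum_le_hugeGroup hg
        refine (hK g).2 ⟨hmem g hg', ?_⟩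
        rw [(hq g hg').2 (Set.Finite.subset hg fun j hj e => hj (e ▸ one_mem _))]
        exact one_mem _
      · obtain ⟨x, hxN, hx1⟩ := N.bot_or_exists_ne_one.resolve_left hbot
        obtain ⟨g, hg, rfl⟩ := hlift x
        exact ⟨g, (hK g).2 ⟨hmem g hg, hxN⟩, hg, fun hfin => hx1 ((hq g hg).2 hfin)⟩
    rw [eq_top_iff]
    intro x _
    obtain ⟨g, hg, rfl⟩ := hlift x
    exact ((hK g).1 (hle hg)).2

end Quotient

end General

end Telescope

namespace WordMatrix

section Entries

variable {Z F : Type*} [Fintype Z] [DecidableEq Z] [CommRing F]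

theorem mul_apply_of_col {A A' : Matrix Z Z F} {w : Z}
    (h : ∀ y, A' y w = (1 : Matrix Z Z F) y w) (z : Z) : (A * A') z w = A z w := by
  rw [Matrix.mul_apply]
  simp [h, Matrix.one_apply]

theorem mul_apply_of_row {A A' : Matrix Z Z F} {z : Z}
    (h : ∀ y, A z y = (1 : Matrix Z Z F) z y) (w : Z) : (A * A') z w = A' z w := by
  rw [Matrix.mul_apply]
  simp [h, Matrix.one_apply]

omit [DecidableEq Z] in
theorem exists_of_mul_apply_ne_zero {A A' : Matrix Z Z F} {z w : Z} (h : (A * A') z w ≠ 0) :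
    ∃ y, A z y ≠ 0 ∧ A' y w ≠ 0 := by
  rw [Matrix.mul_apply] at h
  obtain ⟨y, -, hy⟩ := Finset.exists_ne_zero_of_sum_ne_zero h
  exact ⟨y, left_ne_zero_of_mul hy, right_ne_zero_of_mul hy⟩

end Entries

/-! ### Coherence of the coordinates of elements of the huge group. -/

section Tame

variable {d : ℕ} {F : Type*} [Field F]

/-- A sequence of matrices over words: the coordinate at `j` is indexed by words of length
`j + 1`. -/
abbrev Family (d : ℕ) (F : Type*) [Field F] : Type _ :=
  ∀ j : ℕ, Matrix.SpecialLinearGroup (Fin (j + 1) → Fin d) F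

/-- The block diagonal inclusion between consecutive coordinates. -/
abbrev stepInclusion (F : Type*) [Field F] (d j : ℕ) :
    Matrix.SpecialLinearGroup (Fin (j + 1) → Fin d) F →*
      Matrix.SpecialLinearGroup (Fin (j + 2) → Fin d) F :=
  blockInclusion F (Fin d) (Nat.succ_le_succ j.le_succ)

/-- The word `w` without its last letter. -/
def wordInit {n : ℕ} (w : Fin (n + 1) → Fin d) : Fin n → Fin d := fun k => w k.castSucc

theorem stepInclusion_apply (j : ℕ) (A : Matrix.SpecialLinearGroup (Fin (j + 1) → Fin d) F)
    (u v : Fin (j + 2) → Fin d) :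
    (stepInclusion F d j A : Matrix (Fin (j + 2) → Fin d) (Fin (j + 2) → Fin d) F) u v =
      if u (Fin.last _) = v (Fin.last _) then
        (A : Matrix (Fin (j + 1) → Fin d) (Fin (j + 1) → Fin d) F) (wordInit u) (wordInit v)
      else 0 := by
  rw [blockInclusion_apply]
  refine if_congr ⟨fun h => h _ le_rfl, fun h k hk => ?_⟩ rfl rfl
  have : k = Fin.last _ := Fin.ext (le_antisymm (Nat.le_of_lt_succ k.2) hk)
  rw [this, h]

/-- The word `w` of length `j + 2` agrees, from position `n` on, with a word of the spine, up to
its last letter. -/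
def Active (n j : ℕ) (w : Fin (j + 2) → Fin d) : Prop :=
  ∀ k : Fin (j + 2), n ≤ k → ((k : ℕ) < j → (w k : ℕ) = d - 1) ∧ ((k : ℕ) = j → (w k : ℕ) < 2)

theorem Active.mono {m n j : ℕ} (h : m ≤ n) {w : Fin (j + 2) → Fin d} (hw : Active m j w) :
    Active n j w := fun k hk => hw k (h.trans hk)

/-- Sequences whose consecutive coordinates agree except at active words, and which preserve
active words. -/
structure Tame (g : Family d F) : Prop where
  support : ∀ n, ∃ n', n ≤ n' ∧ ∀ j, n' ≤ j → ∀ y w,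
    (g (j + 1) : Matrix (Fin (j + 2) → Fin d) (Fin (j + 2) → Fin d) F) y w ≠ 0 →
      (Active n j y → Active n' j w) ∧ (Active n j w → Active n' j y)
  coherent : ∃ n, ∀ j, n ≤ j → ∀ z w, ¬ Active n j z ∨ ¬ Active n j w →
    (g (j + 1) : Matrix (Fin (j + 2) → Fin d) (Fin (j + 2) → Fin d) F) z w =
      (stepInclusion F d j (g j) : Matrix (Fin (j + 2) → Fin d) (Fin (j + 2) → Fin d) F) z w

/-- This closure is the reason for the `support` condition: an entry of a product at an inactive
word is a sum over intermediate words, and `support` keeps those that contribute inactive, with a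
smaller threshold, so that both factors are coherent there. -/
theorem Tame.mul {g h : Family d F} (hg : Tame g) (hh : Tame h) : Tame (g * h) where
  support n := by
    obtain ⟨a, hna, ha⟩ := hg.support n
    obtain ⟨a', haa', ha'⟩ := hh.support a
    obtain ⟨b, hnb, hb⟩ := hh.support n
    obtain ⟨b', hbb', hb'⟩ := hg.support b
    refine ⟨max a' b', by omega, fun j hj y w hyw => ?_⟩
    rw [Pi.mul_apply, Matrix.SpecialLinearGroup.coe_mul] at hyw
    obtain ⟨x, hx, hx'⟩ := exists_of_mul_apply_ne_zero hyw
    constructor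
    · intro hy
      exact ((ha' j (by omega) _ _ hx').1 ((ha j (by omega) _ _ hx).1 hy)).mono (le_max_left _ _)
    · intro hw
      exact ((hb' j (by omega) _ _ hx).2 ((hb j (by omega) _ _ hx').2 hw)).mono (le_max_right _ _)
  coherent := by
    obtain ⟨p, hp⟩ := hg.coherent
    obtain ⟨q, hq⟩ := hh.coherent
    obtain ⟨a, hna, ha⟩ := hh.support (max p q)
    obtain ⟨b, hnb, hb⟩ := hg.support (max p q)
    refine ⟨max a b, fun j hj z w hzw => ?_⟩
    rw [Pi.mul_apply, Pi.mul_apply, map_mul, Matrix.SpecialLinearGroup.coe_mul,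
      Matrix.SpecialLinearGroup.coe_mul, Matrix.mul_apply, Matrix.mul_apply]
    refine Finset.sum_congr rfl fun y _ => ?_
    rcases hzw with hz | hw
    · rw [hp j (by omega) z y (Or.inl fun h => hz (h.mono (by omega)))]
      by_cases h0 : (stepInclusion F d j (g j) :
          Matrix (Fin (j + 2) → Fin d) (Fin (j + 2) → Fin d) F) z y = 0
      · rw [h0, zero_mul, zero_mul]
      · rw [← hp j (by omega) z y (Or.inl fun h => hz (h.mono (by omega)))] at h0
        rw [hq j (by omega) y w (Or.inl fun h => hz
          (((hb j (by omega) _ _ h0).2 (h.mono (le_max_right _ _))).mono (by omega)))]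
    · rw [hq j (by omega) y w (Or.inr fun h => hw (h.mono (by omega)))]
      by_cases h0 : (stepInclusion F d j (h j) :
          Matrix (Fin (j + 2) → Fin d) (Fin (j + 2) → Fin d) F) y w = 0
      · rw [h0, mul_zero, mul_zero]
      · rw [← hq j (by omega) y w (Or.inr fun h => hw (h.mono (by omega)))] at h0
        rw [hp j (by omega) z y (Or.inr fun h => hw
          (((ha j (by omega) _ _ h0).1 (h.mono (le_max_left _ _))).mono (by omega)))]

variable (hd : 4 ≤ d)

/-- A ⊗ 1 only relates words that agree from position i + 1 on, so activity with a threshold at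
least i + 1 is preserved; from coordinate `i` on coherence is exact. -/
theorem tame_delta (i : ℕ) (a : (slTelescope d hd F).Ω i) :
    Tame ((slTelescope d hd F).delta i a : Family d F) where
  support n := by
    refine ⟨max n (i + 1), le_max_left _ _, fun j hj y w hyw => ?_⟩
    have hij : i ≤ j + 1 := by omega
    rw [(slTelescope d hd F).delta_apply hij] at hyw
    have hyw' := (blockInclusion_apply (Nat.succ_le_succ hij) a y w).symm.trans_ne hyw
    have h : ∀ k : Fin (j + 2), i + 1 ≤ k → y k = w k := by
      by_contra h
      exact hyw' (if_neg h)
    refine ⟨fun hy k hk => ?_, fun hw k hk => ?_⟩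
    · rw [← h k (by omega)]
      exact hy k (by omega)
    · rw [h k (by omega)]
      exact hw k (by omega)
  coherent := by
    refine ⟨i, fun j hj z w _ => ?_⟩
    rw [(slTelescope d hd F).delta_apply (show i ≤ j + 1 by omega),
      (slTelescope d hd F).delta_apply hj]
    exact congrArg (fun A : Matrix.SpecialLinearGroup (Fin (j + 2) → Fin d) F =>
      (A : Matrix (Fin (j + 2) → Fin d) (Fin (j + 2) → Fin d) F) z w)
      ((slTelescope d hd F).ι_trans i j (j + 1) hj j.le_succ a).symm

theorem active_of_mem_range_spine {j : ℕ} {w : Fin (j + 2) → Fin d}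
    (hw : w ∈ Set.range (spine hd j)) : Active 0 j w := by
  obtain ⟨p, rfl⟩ := hw
  intro k _
  rw [spine_apply]
  refine ⟨fun h => by rw [if_pos h], fun h => ?_⟩
  rw [if_neg (by omega), if_pos h]
  exact p.1.2

/-- The coordinates of `b̃`, as matrices. -/
noncomputable def tildeSL (b : Matrix.SpecialLinearGroup (Fin 2 × Fin d) F) : Family d F :=
  (slTelescope d hd F).tilde b

theorem tildeSL_succ (b : Matrix.SpecialLinearGroup (Fin 2 × Fin d) F) (j : ℕ) :
    tildeSL hd b (j + 1) = stepInclusion F d j (tildeSL hd b j) * extend (spine hd j) b :=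
  (slTelescope d hd F).tilde_succ b j

/-- Both orders are needed: the spine factor must stand on the left to compare rows and on the right
to compare columns. -/
theorem tildeSL_succ' (b : Matrix.SpecialLinearGroup (Fin 2 × Fin d) F) (j : ℕ) :
    tildeSL hd b (j + 1) = extend (spine hd j) b * stepInclusion F d j (tildeSL hd b j) :=
  (tildeSL_succ hd b j).trans ((slTelescope d hd F).commute_tilde j j le_rfl b b)

/-- The factors of b̃ are supported on disjoint sets of words, so a nonzero off-diagonal entry comes
from a single factor `i`, which changes only the letters in positions i and i + 1 behind the prefix
x_d^i. -/
theorem tildeSL_support (b : Matrix.SpecialLinearGroup (Fin 2 × Fin d) F) (j : ℕ)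
    (y w : Fin (j + 1) → Fin d)
    (h : (tildeSL hd b j : Matrix (Fin (j + 1) → Fin d) (Fin (j + 1) → Fin d) F) y w ≠ 0) :
    y = w ∨ ∃ i < j, ∀ l : Fin (j + 1),
      ((l : ℕ) < i → (y l : ℕ) = d - 1 ∧ (w l : ℕ) = d - 1) ∧
      ((l : ℕ) = i → (y l : ℕ) < 2 ∧ (w l : ℕ) < 2) ∧ (i + 2 ≤ (l : ℕ) → y l = w l) := by
  induction j with
  | zero =>
    left
    by_contra hne
    exact h (Matrix.one_apply_ne hne)
  | succ j ih =>
    rw [tildeSL_succ, Matrix.SpecialLinearGroup.coe_mul] at h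
    obtain ⟨x, hyx, hxw⟩ := exists_of_mul_apply_ne_zero h
    rw [stepInclusion_apply] at hyx
    have hlast : y (Fin.last _) = x (Fin.last _) := by
      by_contra hne
      exact hyx (if_neg hne)
    rw [if_pos hlast] at hyx
    have hinit := ih _ _ hyx
    have hyx' : wordInit y = wordInit x → y = x := by
      intro e
      funext l
      refine Fin.lastCases hlast (fun l => ?_) l
      exact congrFun e l
    by_cases hr : x ∉ Set.range (spine hd j) ∨ w ∉ Set.range (spine hd j)
    · rw [extend_apply_of_notMem _ _ _ _ hr] at hxw
      have hxw' : x = w := by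
        by_contra hne
        exact hxw (Matrix.one_apply_ne hne)
      subst hxw'
      rcases hinit with e | ⟨i, hi, hil⟩
      · exact Or.inl (hyx' e)
      · refine Or.inr ⟨i, by omega, fun l => ?_⟩
        refine Fin.lastCases ?_ (fun l => ?_) l
        · simp only [Fin.val_last]
          exact ⟨fun _ => by omega, fun _ => by omega, fun _ => hlast⟩
        · exact hil l
    · push Not at hr
      have hx := active_of_mem_range_spine hd hr.1
      have hw := active_of_mem_range_spine hd hr.2
      -- A spine word has the letter d - 1 ≥ 3 in every position below `j`, so no earlier factor
      -- moves it.
      have hxy : y = x := by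
        rcases hinit with e | ⟨i, hi, hil⟩
        · exact hyx' e
        · exfalso
          have h1 := ((hil ⟨i, by omega⟩).2.1 rfl).2
          have h2 := (hx (Fin.castSucc ⟨i, by omega⟩) (Nat.zero_le _)).1 hi
          change (x (Fin.castSucc ⟨i, by omega⟩) : ℕ) < 2 at h1
          omega
      subst hxy
      refine Or.inr ⟨j, by omega, fun l => ⟨fun hl => ?_, fun hl => ?_, fun hl => ?_⟩⟩
      · exact ⟨(hx l (Nat.zero_le _)).1 hl, (hw l (Nat.zero_le _)).1 hl⟩
      · exact ⟨(hx l (Nat.zero_le _)).2 hl, (hw l (Nat.zero_le _)).2 hl⟩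
      · have := l.2
        omega

theorem tame_tilde (b : Matrix.SpecialLinearGroup (Fin 2 × Fin d) F) : Tame (tildeSL hd b) where
  support n := by
    have aux : ∀ j, n + 1 ≤ j → ∀ y w : Fin (j + 2) → Fin d,
        (y = w ∨ ∃ i < j + 1, ∀ l : Fin (j + 2),
          ((l : ℕ) < i → (y l : ℕ) = d - 1 ∧ (w l : ℕ) = d - 1) ∧
          ((l : ℕ) = i → (y l : ℕ) < 2 ∧ (w l : ℕ) < 2) ∧ (i + 2 ≤ (l : ℕ) → y l = w l)) →
        Active n j y → Active (n + 1) j w := by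
      rintro j hj y w (rfl | ⟨i, hi, hil⟩) hy
      · exact hy.mono (Nat.le_succ n)
      -- A factor i < n keeps the letters from i + 2 ≤ n + 1 on, hence the threshold n + 1. If i ≥
      -- n, activity of `y` forces i = j, and then `w` is active from 0 on.
      · by_cases hin : i < n
        · intro k hk
          rw [← (hil k).2.2 (by omega)]
          exact hy k (by omega)
        · have hij : i = j := by
            by_contra hne
            have h1 := ((hil ⟨i, by omega⟩).2.1 rfl).1
            have h2 := (hy ⟨i, by omega⟩ (not_lt.1 hin)).1 (by change i < j; omega)
            omega
          subst hij
          exact fun k _ => ⟨fun h => ((hil k).1 h).2, fun h => ((hil k).2.1 h).2⟩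
    refine ⟨n + 1, Nat.le_succ n, fun j hj y w hyw => ?_⟩
    have h := tildeSL_support hd b _ _ _ hyw
    refine ⟨aux j hj y w h, aux j hj w y ?_⟩
    refine h.imp Eq.symm fun ⟨i, hi, hil⟩ => ⟨i, hi, fun l => ?_⟩
    exact ⟨fun hl => ((hil l).1 hl).symm, fun hl => ((hil l).2.1 hl).symm,
      fun hl => ((hil l).2.2 hl).symm⟩
  coherent := by
    refine ⟨0, fun j _ z w hzw => ?_⟩
    rcases hzw with hz | hw
    · rw [tildeSL_succ', Matrix.SpecialLinearGroup.coe_mul]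
      exact mul_apply_of_row (fun y => extend_apply_of_notMem _ _ _ _
        (Or.inl fun h => hz (active_of_mem_range_spine hd h))) w
    · rw [tildeSL_succ, Matrix.SpecialLinearGroup.coe_mul]
      exact mul_apply_of_col (fun y => extend_apply_of_notMem _ _ _ _
        (Or.inr fun h => hw (active_of_mem_range_spine hd h))) z

theorem tame_of_mem_hugeGroup {g : ∀ j, (slTelescope d hd F).Ω j}
    (hg : g ∈ (slTelescope d hd F).hugeGroup) : Tame (g : Family d F) :=
  (slTelescope d hd F).hugeGroup_induction (p := fun g => Tame (g : Family d F))
    (tame_delta hd) (tame_tilde hd) (fun _ _ hf hg => hf.mul hg) hg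

end Tame

end WordMatrix

namespace WordMatrix

/-! ### Rigidity at words off the spine. -/

section Rigidity

variable {d : ℕ} {F : Type*} [Field F]

open Matrix.SpecialLinearGroup (transvection transvection_coe)

/-- The sequence `g` is coherent from `n` on: consecutive coordinates agree except at active
words. -/
def CoherentFrom (n : ℕ) (g : Family d F) : Prop :=
  ∀ j, n ≤ j → ∀ z w, ¬ Active n j z ∨ ¬ Active n j w →
    (g (j + 1) : Matrix (Fin (j + 2) → Fin d) (Fin (j + 2) → Fin d) F) z w =
      (stepInclusion F d j (g j) : Matrix (Fin (j + 2) → Fin d) (Fin (j + 2) → Fin d) F) z w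

theorem CoherentFrom.mono {m n : ℕ} (h : m ≤ n) {g : Family d F} (hg : CoherentFrom m g) :
    CoherentFrom n g := fun j hj z w hzw =>
  hg j (h.trans hj) z w (hzw.imp (mt (Active.mono h)) (mt (Active.mono h)))

/-- The matrix entries of a coherent sequence at words with letter `2` in position `N` are
determined by its coordinate at `N`. -/
theorem CoherentFrom.apply_eq (hd : 4 ≤ d) {n : ℕ} {g : Family d F} (hg : CoherentFrom n g) {N : ℕ}
    (hN : n ≤ N) {j : ℕ} (hj : N ≤ j) (z w : Fin (j + 1) → Fin d)
    (hzw : (z ⟨N, by omega⟩ : ℕ) = 2 ∨ (w ⟨N, by omega⟩ : ℕ) = 2) :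
    (g j : Matrix (Fin (j + 1) → Fin d) (Fin (j + 1) → Fin d) F) z w =
      (blockInclusion F (Fin d) (Nat.succ_le_succ hj) (g N) :
        Matrix (Fin (j + 1) → Fin d) (Fin (j + 1) → Fin d) F) z w := by
  induction j, hj using Nat.le_induction with
  | base => rw [blockInclusion_refl]
  | succ j hj ih =>
    -- The letter 2 is neither below 2 nor equal to d - 1; this needs four letters.
    have aux : ∀ w : Fin (j + 2) → Fin d, (w ⟨N, by omega⟩ : ℕ) = 2 → ¬ Active n j w := by
      intro w hw h
      obtain ⟨h1, h2⟩ := h ⟨N, by omega⟩ hN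
      rcases hj.lt_or_eq with hlt | heq
      · have := h1 hlt
        omega
      · have := h2 heq
        omega
    rw [hg j (hN.trans hj) z w (hzw.imp (aux z) (aux w)),
      ← blockInclusion_trans (Nat.succ_le_succ hj) (Nat.succ_le_succ j.le_succ),
      stepInclusion_apply, stepInclusion_apply]
    exact if_congr Iff.rfl (ih _ _ hzw) rfl

/-- The matrix t ⊗ 1 - 1 only involves words with letter 2 in position `N`. In the corresponding
columns g_j agrees with g_N ⊗ 1, and in the corresponding rows the inverses agree. -/
theorem CoherentFrom.conj_blockInclusion_transvection (hd : 4 ≤ d) {n : ℕ} {g : Family d F}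
    (hg : CoherentFrom n g) (hg' : CoherentFrom n g⁻¹) {N : ℕ} (hN : n ≤ N)
    {w w' : Fin (N + 1) → Fin d} (hww' : w ≠ w') (hw : (w (Fin.last N) : ℕ) = 2)
    (hw' : (w' (Fin.last N) : ℕ) = 2) (c : F) {j : ℕ} (hj : N ≤ j) :
    g j * blockInclusion F (Fin d) (Nat.succ_le_succ hj) (transvection hww' c) * (g j)⁻¹ =
      blockInclusion F (Fin d) (Nat.succ_le_succ hj) (g N * transvection hww' c * (g N)⁻¹) := by
  apply slExt
  rw [map_mul, map_mul, map_inv]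
  simp only [Matrix.SpecialLinearGroup.coe_mul]
  set T := blockInclusion F (Fin d) (Nat.succ_le_succ hj) (transvection hww' c)
  set G := blockInclusion F (Fin d) (Nat.succ_le_succ hj) (g N) with hG
  have hT : ∀ u v : Fin (j + 1) → Fin d,
      ((T : Matrix (Fin (j + 1) → Fin d) (Fin (j + 1) → Fin d) F) - 1) u v ≠ 0 →
      (u ⟨N, by omega⟩ : ℕ) = 2 ∧ (v ⟨N, by omega⟩ : ℕ) = 2 := by
    intro u v huv
    rw [Matrix.sub_apply, blockInclusion_apply] at huv
    by_cases h : ∀ k : Fin (j + 1), N + 1 ≤ k → u k = v k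
    · rw [if_pos h, transvection_coe, Matrix.add_apply, single_apply] at huv
      split_ifs at huv with h1
      · have e1 := congrFun h1.1 (Fin.last N)
        have e2 := congrFun h1.2 (Fin.last N)
        rw [e1] at hw
        rw [e2] at hw'
        exact ⟨hw, hw'⟩
      · exfalso
        apply huv
        rw [add_zero, Matrix.one_apply, Matrix.one_apply]
        refine sub_eq_zero.2 (if_congr ⟨fun e => ?_, fun e => e ▸ rfl⟩ rfl rfl)
        funext k
        by_cases hk : N + 1 ≤ (k : ℕ)
        · exact h k hk
        · exact congrFun e ⟨k, by omega⟩
    · rw [if_neg h] at huv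
      refine absurd ?_ huv
      rw [Matrix.one_apply_ne (fun e => h fun k _ => congrFun e k), sub_zero]
  have expand : ∀ A : Matrix.SpecialLinearGroup (Fin (j + 1) → Fin d) F,
      (A : Matrix (Fin (j + 1) → Fin d) (Fin (j + 1) → Fin d) F) * T *
        (A⁻¹ : Matrix.SpecialLinearGroup (Fin (j + 1) → Fin d) F) =
      1 + A * ((T : Matrix (Fin (j + 1) → Fin d) (Fin (j + 1) → Fin d) F) - 1) *
        (A⁻¹ : Matrix.SpecialLinearGroup (Fin (j + 1) → Fin d) F) := by
    intro A
    have hA : (A : Matrix (Fin (j + 1) → Fin d) (Fin (j + 1) → Fin d) F) *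
        (A⁻¹ : Matrix.SpecialLinearGroup (Fin (j + 1) → Fin d) F) = 1 := by
      rw [← Matrix.SpecialLinearGroup.coe_mul, mul_inv_cancel, Matrix.SpecialLinearGroup.coe_one]
    rw [mul_sub, mul_one, sub_mul, hA, add_sub_cancel]
  rw [expand, expand]
  have h1 : (g j : Matrix (Fin (j + 1) → Fin d) (Fin (j + 1) → Fin d) F) *
      ((T : Matrix (Fin (j + 1) → Fin d) (Fin (j + 1) → Fin d) F) - 1) =
      G * ((T : Matrix (Fin (j + 1) → Fin d) (Fin (j + 1) → Fin d) F) - 1) := by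
    ext u v
    rw [Matrix.mul_apply, Matrix.mul_apply]
    refine Finset.sum_congr rfl fun y _ => ?_
    by_cases hy : ((T : Matrix (Fin (j + 1) → Fin d) (Fin (j + 1) → Fin d) F) - 1) y v = 0
    · rw [hy, mul_zero, mul_zero]
    · rw [hg.apply_eq hd hN hj u y (Or.inr (hT _ _ hy).1)]
  have h2 : ((T : Matrix (Fin (j + 1) → Fin d) (Fin (j + 1) → Fin d) F) - 1) *
        ((g j)⁻¹ : Matrix.SpecialLinearGroup (Fin (j + 1) → Fin d) F) =
      ((T : Matrix (Fin (j + 1) → Fin d) (Fin (j + 1) → Fin d) F) - 1) *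
        (G⁻¹ : Matrix.SpecialLinearGroup (Fin (j + 1) → Fin d) F) := by
    ext u v
    rw [Matrix.mul_apply, Matrix.mul_apply]
    refine Finset.sum_congr rfl fun y _ => ?_
    by_cases hy : ((T : Matrix (Fin (j + 1) → Fin d) (Fin (j + 1) → Fin d) F) - 1) u y = 0
    · rw [hy, zero_mul, zero_mul]
    · have := hg'.apply_eq hd hN hj y v (Or.inl (hT _ _ hy).2)
      rw [Pi.inv_apply, Pi.inv_apply, map_inv] at this
      rw [hG, this]
  rw [h1, mul_assoc, h2, mul_assoc]

/-- If the coordinates of a coherent sequence commute with all elementary matrices at words with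
last letter `2`, then they are scalar from some point on. -/
theorem CoherentFrom.mem_center (hd : 4 ≤ d) {n : ℕ} {g : Family d F} (hg : CoherentFrom n g)
    (h : ∀ N, n ≤ N → ∀ w w' : Fin (N + 1) → Fin d, w ≠ w' → (w (Fin.last N) : ℕ) = 2 →
      (w' (Fin.last N) : ℕ) = 2 →
      Commute (single w w' (1 : F)) (g N : Matrix (Fin (N + 1) → Fin d) (Fin (N + 1) → Fin d) F))
    {N : ℕ} (hN : n + 2 ≤ N) :
    g N ∈ Subgroup.center (Matrix.SpecialLinearGroup (Fin (N + 1) → Fin d) F) := by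
  have hscal : ∀ N, n ≤ N → 1 ≤ N → ∃ c : F, ∀ z w : Fin (N + 1) → Fin d,
      (w (Fin.last N) : ℕ) = 2 →
      (g N : Matrix (Fin (N + 1) → Fin d) (Fin (N + 1) → Fin d) F) z w = if z = w then c else 0 := by
    intro N hnN hN
    -- Words ending in 2 that differ in position 0; two distinct ones require N ≥ 1.
    let u : Fin d → Fin (N + 1) → Fin d := fun a k => if (k : ℕ) = N then ⟨2, by omega⟩ else a
    have hu : ∀ a, (u a (Fin.last N) : ℕ) = 2 := fun a => by simp [u]
    have hu' : u ⟨0, by omega⟩ ≠ u ⟨1, by omega⟩ := by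
      intro e
      have := congrArg Fin.val (congrFun e ⟨0, by omega⟩)
      simp [u, show (0 : ℕ) ≠ N by omega] at this
    have hex : ∀ w : Fin (N + 1) → Fin d, ∃ w', w ≠ w' ∧ (w' (Fin.last N) : ℕ) = 2 := by
      intro w
      by_cases hw : w = u ⟨0, by omega⟩
      · exact ⟨_, hw ▸ hu', hu _⟩
      · exact ⟨_, hw, hu _⟩
    refine ⟨(g N : Matrix (Fin (N + 1) → Fin d) (Fin (N + 1) → Fin d) F)
      (u ⟨0, by omega⟩) (u ⟨0, by omega⟩), fun z w hw => ?_⟩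
    split_ifs with hzw
    · subst hzw
      by_cases hz : z = u ⟨0, by omega⟩
      · rw [hz]
      · exact diag_eq_of_commute_single (h N hnN _ _ hz hw (hu _))
    · obtain ⟨w', hww', hw'⟩ := hex w
      exact col_eq_zero_of_commute_single (h N hnN _ _ hww' hw hw') hzw
  -- Appending the letter 2 to `w` gives a known column one level up, and coherence brings it down
  -- when the longer word is inactive. The condition on `w` is exactly this inactivity.
  have hmain : ∀ N, n ≤ N → ∀ c : F,
      (∀ z w : Fin (N + 2) → Fin d, (w (Fin.last (N + 1)) : ℕ) = 2 →
        (g (N + 1) : Matrix (Fin (N + 2) → Fin d) (Fin (N + 2) → Fin d) F) z w =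
          if z = w then c else 0) →
      ∀ z w : Fin (N + 1) → Fin d, (2 ≤ (w (Fin.last N) : ℕ) ∨
        ∃ k : Fin (N + 1), n ≤ k ∧ (k : ℕ) < N ∧ (w k : ℕ) ≠ d - 1) →
        (g N : Matrix (Fin (N + 1) → Fin d) (Fin (N + 1) → Fin d) F) z w =
          if z = w then c else 0 := by
    intro N hnN c hc z w hw
    let ext : (Fin (N + 1) → Fin d) → Fin (N + 2) → Fin d :=
      fun w => Fin.snoc (α := fun _ => Fin d) w ⟨2, by omega⟩
    have ext_last : ∀ w, ext w (Fin.last (N + 1)) = ⟨2, by omega⟩ := fun w => by simp [ext]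
    have ext_cast : ∀ w (k : Fin (N + 1)), ext w k.castSucc = w k := fun w k => by simp [ext]
    have ext_init : ∀ w, wordInit (ext w) = w := fun w => funext (ext_cast w)
    have hact : ¬ Active n N (ext w) := by
      intro h
      rcases hw with hw | ⟨k, hnk, hkN, hwk⟩
      · have := (h (Fin.last N).castSucc hnN).2 rfl
        rw [ext_cast] at this
        omega
      · have := (h k.castSucc hnk).1 hkN
        rw [ext_cast] at this
        exact hwk this
    have h1 := hg N hnN (ext z) (ext w) (Or.inr hact)
    rw [stepInclusion_apply, ext_last, ext_last, if_pos rfl, ext_init, ext_init,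
      hc _ _ (by rw [ext_last])] at h1
    rw [← h1]
    exact if_congr ⟨fun e => by rw [← ext_init z, ← ext_init w, e], fun e => by rw [e]⟩ rfl rfl
  obtain ⟨N, rfl⟩ : ∃ m, N = m + 1 := ⟨N - 1, by omega⟩
  -- One scalar, read off one level above the target, serves for both N + 1 and N.
  obtain ⟨c, hc⟩ := hscal (N + 2) (by omega) (by omega)
  have h1 := hmain (N + 1) (by omega) c hc
  have h0 := hmain N (by omega) c fun z w hw => h1 z w (Or.inl hw.ge)
  have hall : (g (N + 1) : Matrix (Fin (N + 2) → Fin d) (Fin (N + 2) → Fin d) F) =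
      scalar (Fin (N + 2) → Fin d) c := by
    ext z w
    rw [scalar_apply, diagonal_apply]
    by_cases hw : 2 ≤ (w (Fin.last (N + 1)) : ℕ) ∨
        ∃ k : Fin (N + 2), n ≤ k ∧ (k : ℕ) < N + 1 ∧ (w k : ℕ) ≠ d - 1
    · exact h1 z w hw
    -- The remaining words have x_d in position `N`, where an active word would have x_1 or x_2.
    -- Coherence reduces them to their prefixes, whose last letter d - 1 ≥ 2 is covered by `h0`.
    · push Not at hw
      have hwN : (w (Fin.last N).castSucc : ℕ) = d - 1 :=
        hw.2 (Fin.last N).castSucc (by simp; omega) (by simp)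
      rw [hg N (by omega) z w (Or.inr fun h => by
        have := (h (Fin.last N).castSucc (by simp; omega)).2 rfl
        omega), stepInclusion_apply, h0 _ _ (Or.inl (by change 2 ≤ (w _ : ℕ); omega)), ← ite_and]
      refine if_congr ⟨fun e => ?_, fun e => e ▸ ⟨rfl, rfl⟩⟩ rfl rfl
      funext k
      refine Fin.lastCases e.1 (fun k => ?_) k
      exact congrFun e.2 k
  refine Matrix.SpecialLinearGroup.mem_center_iff.2 ⟨c, ?_, hall.symm⟩
  have hdet := (g (N + 1)).2
  rw [hall] at hdet
  simpa using! hdet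

end Rigidity

end WordMatrix

namespace WordMatrix

/-! ### Supports of products and conjugates. -/

section Support

variable {Z F : Type*} [Fintype Z] [DecidableEq Z] [Field F]

theorem SupportedIn.mul {T : Set Z} {A A' : Matrix Z Z F} (hA : SupportedIn T A)
    (hA' : SupportedIn T A') : SupportedIn T (A * A') := by
  rintro u v (hu | hv)
  · rw [mul_apply_of_row fun y => hA u y (Or.inl hu)]
    exact hA' u v (Or.inl hu)
  · rw [mul_apply_of_col fun y => hA' y v (Or.inr hv)]
    exact hA u v (Or.inr hv)

/-- Since GAG⁻¹ - 1 = G(A - 1)G⁻¹, a nonzero entry of it factors through two indices in `T`. -/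
theorem SupportedIn.conj {T U : Set Z} {A G : Matrix.SpecialLinearGroup Z F}
    (hA : SupportedIn T (A : Matrix Z Z F))
    (h : ∀ u x, (G : Matrix Z Z F) u x ≠ 0 → x ∈ T → u ∈ U)
    (h' : ∀ y v, ((G⁻¹ : Matrix.SpecialLinearGroup Z F) : Matrix Z Z F) y v ≠ 0 → y ∈ T → v ∈ U) :
    SupportedIn U ((G * A * G⁻¹ : Matrix.SpecialLinearGroup Z F) : Matrix Z Z F) := by
  have hG : (G : Matrix Z Z F) * (G⁻¹ : Matrix.SpecialLinearGroup Z F) = 1 := by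
    rw [← Matrix.SpecialLinearGroup.coe_mul, mul_inv_cancel, Matrix.SpecialLinearGroup.coe_one]
  have hexp : ((G * A * G⁻¹ : Matrix.SpecialLinearGroup Z F) : Matrix Z Z F) =
      1 + G * ((A : Matrix Z Z F) - 1) * (G⁻¹ : Matrix.SpecialLinearGroup Z F) := by
    rw [Matrix.SpecialLinearGroup.coe_mul, Matrix.SpecialLinearGroup.coe_mul, mul_sub, mul_one,
      sub_mul, hG, add_sub_cancel]
  intro u v huv
  rw [hexp, Matrix.add_apply, add_eq_left]
  by_contra hne
  obtain ⟨y, hy, hyv⟩ := exists_of_mul_apply_ne_zero hne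
  obtain ⟨x, hx, hxy⟩ := exists_of_mul_apply_ne_zero hy
  have hT : x ∈ T ∧ y ∈ T := by
    by_contra hT
    rw [not_and_or] at hT
    exact hxy (by rw [Matrix.sub_apply, hA x y hT, sub_self])
  rcases huv with hu | hv
  · exact hu (h u x hx hT.1)
  · exact hv (h' y v hyv hT.2)

theorem supportedIn_transvection {T : Set Z} {p q : Z} (h : p ≠ q) (hp : p ∈ T) (hq : q ∈ T)
    (c : F) : SupportedIn T (Matrix.SpecialLinearGroup.transvection h c : Matrix Z Z F) := by
  intro u v huv
  rw [Matrix.SpecialLinearGroup.transvection_coe, Matrix.add_apply, single_apply, if_neg, add_zero]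
  rintro ⟨rfl, rfl⟩
  exact huv.elim (fun h => h hp) fun h => h hq

theorem permSL_inv (σ : Equiv.Perm Z) (hσ : Equiv.Perm.sign σ = 1)
    (hσ' : Equiv.Perm.sign σ⁻¹ = 1) :
    (permSL σ hσ : Matrix.SpecialLinearGroup Z F)⁻¹ = permSL σ⁻¹ hσ' := by
  rw [inv_eq_iff_mul_eq_one]
  apply slExt
  ext u v
  rw [Matrix.SpecialLinearGroup.coe_mul, Matrix.mul_apply]
  simp [permSL, Matrix.one_apply]

theorem mem_center_of_entries {A : Matrix.SpecialLinearGroup Z F}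
    (h : ∀ p q, p ≠ q → (A : Matrix Z Z F) p q = 0)
    (h' : ∀ p q, p ≠ q → (A : Matrix Z Z F) p p = (A : Matrix Z Z F) q q) :
    A ∈ Subgroup.center (Matrix.SpecialLinearGroup Z F) := by
  refine Subgroup.mem_center_iff.2 fun g => slExt ?_
  rw [Matrix.SpecialLinearGroup.coe_mul, Matrix.SpecialLinearGroup.coe_mul]
  ext u v
  rw [Matrix.mul_apply, Matrix.mul_apply,
    Finset.sum_eq_single v (fun x _ hx => by rw [h x v hx, mul_zero]) (by simp),
    Finset.sum_eq_single u (fun x _ hx => by rw [h u x hx.symm, zero_mul]) (by simp), mul_comm]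
  by_cases huv : u = v
  · rw [huv]
  · rw [h' u v huv]

end Support

/-! ### Normal subgroups of the head of the word telescope. -/

section NormalSubgroups

variable {d : ℕ} {F : Type*} [Field F]

theorem three_le_card_words (hd : 4 ≤ d) (n : ℕ) : 3 ≤ Fintype.card (Fin (n + 1) → Fin d) := by
  simp only [Fintype.card_fun, Fintype.card_fin]
  calc 3 ≤ d := by omega
    _ = d ^ 1 := (pow_one d).symm
    _ ≤ d ^ (n + 1) := Nat.pow_le_pow_right (by omega) (by omega)

/-- A normal subgroup containing `A ⊗ 1`, with `A` not central, is everything. -/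
theorem eq_top_of_stepInclusion_mem (hd : 4 ≤ d) {j : ℕ}
    {A : Matrix.SpecialLinearGroup (Fin (j + 1) → Fin d) F}
    (hA : A ∉ Subgroup.center (Matrix.SpecialLinearGroup (Fin (j + 1) → Fin d) F))
    (H : Subgroup (Matrix.SpecialLinearGroup (Fin (j + 2) → Fin d) F)) [hH : H.Normal]
    (hAH : stepInclusion F d j A ∈ H) : H = ⊤ := by
  let ext : (Fin (j + 1) → Fin d) → Fin (j + 2) → Fin d :=
    fun w => Fin.snoc (α := fun _ => Fin d) w ⟨0, by omega⟩
  have ext_last : ∀ w, ext w (Fin.last (j + 1)) = ⟨0, by omega⟩ := fun w => by simp [ext]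
  have ext_init : ∀ w, wordInit (ext w) = w := fun w => funext fun k => by simp [ext, wordInit]
  have ext_inj : ∀ {p q}, p ≠ q → ext p ≠ ext q := fun {p q} h e =>
    h (by rw [← ext_init p, ← ext_init q, e])
  have hentry : ∀ p q, (stepInclusion F d j A :
      Matrix (Fin (j + 2) → Fin d) (Fin (j + 2) → Fin d) F) (ext p) (ext q) =
      (A : Matrix (Fin (j + 1) → Fin d) (Fin (j + 1) → Fin d) F) p q := by
    intro p q
    rw [stepInclusion_apply, ext_last, ext_last, if_pos rfl, ext_init, ext_init]
  set G := stepInclusion F d j A with hG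
  -- The block of words ending in x_1 is a copy of `A`; if all these commutators were trivial, `A`
  -- would be scalar.
  obtain ⟨p, q, hpq, hne⟩ : ∃ p q, ∃ h : p ≠ q,
      G * Matrix.SpecialLinearGroup.transvection (ext_inj h) 1 * G⁻¹ *
        (Matrix.SpecialLinearGroup.transvection (ext_inj h) 1)⁻¹ ≠ 1 := by
    by_contra! hall
    have hcomm : ∀ p q, p ≠ q → Commute (single (ext p) (ext q) (1 : F))
        (G : Matrix (Fin (j + 2) → Fin d) (Fin (j + 2) → Fin d) F) := fun p q h =>
      commute_single_of_commutator_mem_center (ext_inj h) (hall p q h ▸ one_mem _)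
    refine hA (mem_center_of_entries (fun p q h => ?_) fun p q h => ?_)
    · rw [← hentry]
      exact col_eq_zero_of_commute_single (hcomm q p h.symm) (ext_inj h)
    · rw [← hentry, ← hentry]
      exact diag_eq_of_commute_single (hcomm p q h)
  let T : Set (Fin (j + 2) → Fin d) := {w | (w (Fin.last _) : ℕ) = 0}
  have hT : ∀ w, ext w ∈ T := fun w => congrArg Fin.val (ext_last w)
  have hblock : ∀ (A : Matrix.SpecialLinearGroup (Fin (j + 1) → Fin d) F) u v,
      (stepInclusion F d j A : Matrix (Fin (j + 2) → Fin d) (Fin (j + 2) → Fin d) F) u v ≠ 0 →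
        u (Fin.last _) = v (Fin.last _) := by
    intro A u v h
    rw [stepInclusion_apply] at h
    by_contra hne
    exact h (if_neg hne)
  -- A ⊗ 1 preserves last letters, so the commutator is supported in the single block `T`, and the
  -- constant words x_2…x_2 and x_3…x_3 lie outside it.
  refine eq_top_of_supportedIn_mem (three_le_card_words hd _) H (T := T)
    (r := fun _ => ⟨1, by omega⟩) (r' := fun _ => ⟨2, by omega⟩) (by simp [T]) (by simp [T]) ?_
    (C := _) ?_ hne ?_
  · intro e
    have := congrArg Fin.val (congrFun e 0)
    simp at this
  · rw [mul_assoc, mul_assoc, ← mul_assoc _ G⁻¹]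
    exact mul_mem hAH (hH.conj_mem _ (inv_mem hAH) _)
  · rw [Matrix.SpecialLinearGroup.coe_mul, Matrix.SpecialLinearGroup.transvection_inv]
    refine ((supportedIn_transvection _ (hT p) (hT q) _).conj (fun u x h hx => ?_)
      fun y v h hy => ?_).mul (supportedIn_transvection _ (hT p) (hT q) _)
    · exact (congrArg Fin.val (hblock A u x h)).trans hx
    · rw [hG, ← map_inv] at h
      exact (congrArg Fin.val (hblock A⁻¹ y v h)).symm.trans hy

variable (hd : 4 ≤ d)

/-- The block argument applies from level N + 1 on, where a non-central A ⊗ 1 is available. Levels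
up to `N` follow by descent, as Δ_j(A) and Δ_{j+1}(A ⊗ 1) differ by an element of the direct sum. -/
theorem deltaComap_eq_top {K : Subgroup (∀ j, (slTelescope d hd F).Ω j)}
    (hK : ∀ g ∈ (slTelescope d hd F).hugeGroup, ∀ k ∈ K, g * k * g⁻¹ ∈ K)
    (hK' : (slTelescope d hd F).directSum ≤ K) {N : ℕ}
    {A : Matrix.SpecialLinearGroup (Fin (N + 1) → Fin d) F}
    (hA : A ∉ Subgroup.center (Matrix.SpecialLinearGroup (Fin (N + 1) → Fin d) F))
    (hAK : A ∈ (slTelescope d hd F).deltaComap K N) (j : ℕ) :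
    (slTelescope d hd F).deltaComap K j = ⊤ := by
  let D : ∀ j : ℕ, Subgroup (Matrix.SpecialLinearGroup (Fin (j + 1) → Fin d) F) :=
    (slTelescope d hd F).deltaComap K
  have hiff : ∀ (j : ℕ) (A : Matrix.SpecialLinearGroup (Fin (j + 1) → Fin d) F),
      stepInclusion F d j A ∈ D (j + 1) ↔ A ∈ D j := (slTelescope d hd F).delta_succ_mem_iff hK'
  have hnorm : ∀ j, (D j).Normal := (slTelescope d hd F).deltaComap_normal hK
  have hstep : ∀ (j : ℕ) (A : Matrix.SpecialLinearGroup (Fin (j + 1) → Fin d) F),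
      A ∉ Subgroup.center (Matrix.SpecialLinearGroup (Fin (j + 1) → Fin d) F) →
      A ∈ D j → D (j + 1) = ⊤ := fun j A hA hAK =>
    have := hnorm (j + 1)
    eq_top_of_stepInclusion_mem hd hA _ ((hiff j A).2 hAK)
  have hup : ∀ j, N + 1 ≤ j → D j = ⊤ := by
    intro j hj
    induction j, hj using Nat.le_induction with
    | base => exact hstep N A hA hAK
    | succ j hj ih =>
      have hne : (fun _ => ⟨0, by omega⟩ : Fin (j + 1) → Fin d) ≠ fun _ => ⟨1, by omega⟩ := by
        intro e
        have := congrArg Fin.val (congrFun e 0)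
        simp at this
      refine hstep j (Matrix.SpecialLinearGroup.transvection hne 1) ?_ (ih ▸ Subgroup.mem_top _)
      rw [Matrix.SpecialLinearGroup.transvection_mem_center_iff]
      exact one_ne_zero
  have hdown : ∀ k j, j + k = N + 1 → D j = ⊤ := by
    intro k
    induction k with
    | zero => exact fun j hj => hup j hj.ge
    | succ k ih =>
      intro j hj
      refine eq_top_iff.2 fun A _ => (hiff j A).1 ?_
      rw [ih (j + 1) (by omega)]
      exact Subgroup.mem_top _
  rcases le_total (N + 1) j with h | h
  · exact hup j h
  · exact hdown (N + 1 - j) j (by omega)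

/-- The coordinates of the tail of `b̃`, as matrices. -/
noncomputable def tailSL (b : Matrix.SpecialLinearGroup (Fin 2 × Fin d) F) : Family d F :=
  (slTelescope d hd F).tail b

/-- Once the first factor is removed, every spine involved begins with x_d. -/
theorem tailSL_supportedIn (b : Matrix.SpecialLinearGroup (Fin 2 × Fin d) F) (j : ℕ) :
    SupportedIn {w : Fin (j + 1) → Fin d | (w 0 : ℕ) = d - 1}
      (tailSL hd b j : Matrix (Fin (j + 1) → Fin d) (Fin (j + 1) → Fin d) F) := by
  have h0 : tailSL hd b 0 = 1 := (slTelescope d hd F).tail_zero b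
  have h1 : tailSL hd b 1 = 1 := (slTelescope d hd F).tail_one b
  have hsucc : ∀ j, tailSL hd b (j + 2) =
      stepInclusion F d (j + 1) (tailSL hd b (j + 1)) * extend (spine hd (j + 1)) b :=
    (slTelescope d hd F).tail_succ b
  induction j with
  | zero =>
    rw [h0]
    exact fun u v _ => rfl
  | succ j ih =>
    cases j with
    | zero =>
      rw [h1]
      exact fun u v _ => rfl
    | succ j =>
      rw [hsucc, Matrix.SpecialLinearGroup.coe_mul]
      refine SupportedIn.mul (fun u v huv => ?_) fun u v huv => ?_
      · rw [stepInclusion_apply, ih (wordInit u) (wordInit v) huv, Matrix.one_apply,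
          Matrix.one_apply, ← ite_and]
        refine if_congr ⟨fun e => ?_, fun e => e ▸ ⟨rfl, rfl⟩⟩ rfl rfl
        funext k
        refine Fin.lastCases e.1 (fun k => ?_) k
        exact congrFun e.2 k
      · have aux : ∀ w : Fin (j + 3) → Fin d, w ∈ Set.range (spine hd (j + 1)) →
            (w 0 : ℕ) = d - 1 := fun w hw =>
          (active_of_mem_range_spine hd hw 0 le_rfl).1 (Nat.succ_pos j)
        exact extend_apply_of_notMem _ _ _ _ (huv.imp (mt (aux u)) (mt (aux v)))

/-- The tail of `b̃` commutes with a conjugate of the tail of `c̃`. -/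
theorem exists_commute_conj_tail (b c : Matrix.SpecialLinearGroup (Fin 2 × Fin d) F) :
    ∃ a, ∀ j, Commute ((slTelescope d hd F).tail b j)
      ((slTelescope d hd F).ι 0 j j.zero_le a * (slTelescope d hd F).tail c j *
        ((slTelescope d hd F).ι 0 j j.zero_le a)⁻¹) := by
  let x : Fin d → Fin 1 → Fin d := fun a _ => a
  have hx : ∀ {a a' : Fin d}, a ≠ a' → x a ≠ x a' := fun h e => h (congrFun e 0)
  let p : Fin d := ⟨d - 1, by omega⟩
  let q : Fin d := ⟨2, by omega⟩
  let r : Fin d := ⟨0, by omega⟩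
  have hpq : p ≠ q := fun e => by have := congrArg Fin.val e; simp only [p, q] at this; omega
  have hpr : p ≠ r := fun e => by have := congrArg Fin.val e; simp only [p, r] at this; omega
  have hqr : q ≠ r := fun e => by have := congrArg Fin.val e; simp [q, r] at this
  -- A transposition of x_d and x_3 is odd, so a 3-cycle through x_1 is used; only evenness and
  -- σ(x_d) = x_3 matter.
  let σ : Equiv.Perm (Fin 1 → Fin d) := Equiv.swap (x p) (x r) * Equiv.swap (x p) (x q)
  have hσ : Equiv.Perm.sign σ = 1 := by
    simp [σ, Equiv.Perm.sign_swap (hx hpq), Equiv.Perm.sign_swap (hx hpr)]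
  have hσ' : Equiv.Perm.sign σ⁻¹ = 1 := by simp [hσ]
  have hσp : σ (x p) = x q := by
    simp [σ, Equiv.swap_apply_of_ne_of_ne (hx hpq).symm (hx hqr)]
  refine ⟨(permSL σ hσ : Matrix.SpecialLinearGroup (Fin 1 → Fin d) F), ?_⟩
  have hentry : ∀ (τ : Equiv.Perm (Fin 1 → Fin d)) (hτ : Equiv.Perm.sign τ = 1) (j : ℕ)
      (u v : Fin (j + 1) → Fin d),
      (blockInclusion F (Fin d) (show 1 ≤ j + 1 by omega) (permSL τ hτ) :
        Matrix (Fin (j + 1) → Fin d) (Fin (j + 1) → Fin d) F) u v ≠ 0 → x (u 0) = τ (x (v 0)) := by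
    intro τ hτ j u v h
    rw [blockInclusion_apply] at h
    by_contra hne
    refine h (ite_eq_right_iff.2 fun _ => ?_)
    have e : ∀ w : Fin (j + 1) → Fin d, (fun k : Fin 1 => w (Fin.castLE (by omega) k)) = x (w 0) :=
      fun w => funext fun k => by rw [Subsingleton.elim k 0]; rfl
    rw [e, e]
    exact Matrix.one_apply_ne hne
  have key : ∀ j : ℕ, tailSL hd b j * (blockInclusion F (Fin d) (show 1 ≤ j + 1 by omega)
      (permSL σ hσ) * tailSL hd c j * (blockInclusion F (Fin d) (show 1 ≤ j + 1 by omega)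
      (permSL σ hσ))⁻¹) = (blockInclusion F (Fin d) (show 1 ≤ j + 1 by omega)
      (permSL σ hσ) * tailSL hd c j * (blockInclusion F (Fin d) (show 1 ≤ j + 1 by omega)
      (permSL σ hσ))⁻¹) * tailSL hd b j := by
    intro j
    apply slExt
    rw [Matrix.SpecialLinearGroup.coe_mul (tailSL hd b j),
      Matrix.SpecialLinearGroup.coe_mul _ (tailSL hd b j)]
    refine SupportedIn.commute (U := {w | w 0 = q}) ?_ (tailSL_supportedIn hd b j)
      ((tailSL_supportedIn hd c j).conj (fun u v h hv => ?_) fun u v h hu => ?_)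
    · rw [Set.disjoint_left]
      intro w hw hw'
      exact hpq ((Fin.ext hw.symm).trans hw')
    · have e := hentry σ hσ j u v h
      rw [show v 0 = p from Fin.ext hv, hσp] at e
      exact congrFun e 0
    · rw [← map_inv, permSL_inv σ hσ hσ'] at h
      have e := hentry σ⁻¹ hσ' j u v h
      rw [show u 0 = p from Fin.ext hu, Equiv.Perm.eq_inv_iff_eq, hσp] at e
      exact (congrFun e 0).symm
  exact key

theorem hugeGroup_le_of_mem {K : Subgroup (∀ j, (slTelescope d hd F).Ω j)}
    (hK : ∀ g ∈ (slTelescope d hd F).hugeGroup, ∀ k ∈ K, g * k * g⁻¹ ∈ K)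
    (hK' : (slTelescope d hd F).directSum ≤ K) {g : ∀ j, (slTelescope d hd F).Ω j} (hgK : g ∈ K)
    (hg : g ∈ (slTelescope d hd F).hugeGroup)
    (hinf : {j | g j ∉ Subgroup.center (Matrix.SpecialLinearGroup (Fin (j + 1) → Fin d) F)}.Infinite) :
    (slTelescope d hd F).hugeGroup ≤ K := by
  let G : Family d F := g
  obtain ⟨m, hm⟩ := (tame_of_mem_hugeGroup hd hg).coherent
  -- Coherence of the inverse comes from g⁻¹ lying in the huge group, not from coherence of `g`.
  obtain ⟨m', hm'⟩ := (tame_of_mem_hugeGroup hd (inv_mem hg)).coherent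
  have hcoh : CoherentFrom (max m m') G :=
    CoherentFrom.mono (le_max_left _ _) hm
  have hcoh' : CoherentFrom (max m m') G⁻¹ :=
    CoherentFrom.mono (le_max_right _ _) hm'
  obtain ⟨N, hN, w, w', hww', hw, hw', hne⟩ : ∃ N, max m m' ≤ N ∧ ∃ w w' : Fin (N + 1) → Fin d,
      ∃ h : w ≠ w', (w (Fin.last N) : ℕ) = 2 ∧ (w' (Fin.last N) : ℕ) = 2 ∧
      G N * Matrix.SpecialLinearGroup.transvection h (1 : F) * (G N)⁻¹ *
        (Matrix.SpecialLinearGroup.transvection h (1 : F))⁻¹ ∉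
          Subgroup.center (Matrix.SpecialLinearGroup (Fin (N + 1) → Fin d) F) := by
    by_contra! hall
    refine hinf ((Set.finite_lt_nat (max m m' + 2)).subset fun j hj => ?_)
    by_contra hlt
    exact hj (hcoh.mem_center hd (fun N hN w w' h hw hw' =>
      commute_single_of_commutator_mem_center h (hall N hN w w' h hw hw')) (not_lt.1 hlt))
  have hmem := (slTelescope d hd F).commutator_mem_deltaComap hK hgK
    (t := Matrix.SpecialLinearGroup.transvection hww' (1 : F))
    fun j hj => hcoh.conj_blockInclusion_transvection hd hcoh' hN hww' hw hw' 1 hj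
  have hΔ : ∀ i a, (slTelescope d hd F).delta i a ∈ K := fun i a =>
    (deltaComap_eq_top hd hK hK' hne hmem i ▸ Subgroup.mem_top a :
      a ∈ (slTelescope d hd F).deltaComap K i)
  refine (slTelescope d hd F).hugeGroup_le_of_delta_mem hK hΔ
    (eq_top_of_commutator_mem ?_) (exists_commute_conj_tail hd)
  simp only [Fintype.card_prod, Fintype.card_fin]
  omega

/-- Gives nontriviality of the head: t ⊗ 1 keeps the off-diagonal entry 1 of an elementary matrix
`t` at words that differ only in the first letter. -/
theorem exists_infinite_not_mem_center : ∃ g ∈ (slTelescope d hd F).hugeGroup,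
    {j | g j ∉ Subgroup.center
      (Matrix.SpecialLinearGroup (Fin (j + 1) → Fin d) F)}.Infinite := by
  have hne : (fun _ => ⟨0, by omega⟩ : Fin 1 → Fin d) ≠ fun _ => ⟨1, by omega⟩ := by
    intro e
    have := congrArg Fin.val (congrFun e 0)
    simp at this
  refine ⟨_, (slTelescope d hd F).delta_mem_hugeGroup 0
    (Matrix.SpecialLinearGroup.transvection hne (1 : F)), ?_⟩
  refine Set.infinite_univ.mono fun j _ => ?_
  intro hmem
  have hc := (congrArg (fun A : Matrix.SpecialLinearGroup (Fin (j + 1) → Fin d) F =>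
      A ∈ Subgroup.center (Matrix.SpecialLinearGroup (Fin (j + 1) → Fin d) F))
    ((slTelescope d hd F).delta_apply (Nat.zero_le j) _)).mp hmem
  obtain ⟨r, -, hr⟩ := Matrix.SpecialLinearGroup.mem_center_iff.1 hc
  let u : Fin d → Fin (j + 1) → Fin d := fun a k => if k = 0 then a else ⟨0, by omega⟩
  have h1 := congrFun (congrFun hr (u ⟨0, by omega⟩)) (u ⟨1, by omega⟩)
  have h2 : u ⟨0, by omega⟩ ≠ u ⟨1, by omega⟩ := by
    intro e
    have := congrArg Fin.val (congrFun e 0)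
    simp [u] at this
  rw [scalar_apply, diagonal_apply_ne _ h2] at h1
  have h3 := blockInclusion_apply (show 1 ≤ j + 1 by omega)
    (Matrix.SpecialLinearGroup.transvection hne (1 : F)) (u ⟨0, by omega⟩) (u ⟨1, by omega⟩)
  have h4 : ∀ a, (fun k : Fin 1 => u a (Fin.castLE (by omega) k)) = fun _ => a := fun a =>
    funext fun k => by rw [Subsingleton.elim k 0]; rfl
  rw [if_pos (fun k hk => by
    have : k ≠ 0 := by rintro rfl; simp at hk
    simp [u, this]), h4, h4, Matrix.SpecialLinearGroup.transvection_coe, Matrix.add_apply,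
    Matrix.one_apply_ne hne, single_apply_same, zero_add] at h3
  exact zero_ne_one (h1.trans h3)

end NormalSubgroups

end WordMatrix

theorem mainTheorem8 (d : ℕ) (hd : 4 ≤ d) (F : Type*) [Field F] :
    IsSimpleGroup (pslTelescope d hd F).head := by
  exact (slTelescope d hd F).isSimpleGroup_head_quotient
    (fun i => Subgroup.center (Matrix.SpecialLinearGroup (Fin (i + 1) → Fin d) F))
    (hN := fun _ => Subgroup.instNormalCenter)
    (fun _ _ h => WordMatrix.blockInclusion_center (Nat.succ_le_succ h))
    (WordMatrix.exists_infinite_not_mem_center hd)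
    (fun _ hK hK' ⟨_, hgK, hg, hinf⟩ => WordMatrix.hugeGroup_le_of_mem hd hK hK' hgK hg hinf)
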